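/- **Setting.** Let $X$ be a paracompact Hausdorff space, $H$ a separable infinite-dimensional complex Hilbert space, and let $H_x$, $x\in X$, be the fibers of a locally trivial Hilbert bundle $\mathbb H$ over $X$ with model fiber $H$. A local trivialization over an open set $U$ is a family of unitary isomorphisms $t_x\colon H_x\to H$, $x\in U$, that gives a homeomorphism of the part of the total space over $U$ with $U\times H$; transition maps are thus only strongly continuous. Let $\mathbb A=(A_x)_{x\in X}$ be a family of (unbounded) self-adjoint operators $A_x$ in $H_x$, none of them essentially positive or essentially negative: for every $x$ both $\operatorname{Im}P_{(-\infty,0]}(A_x)$ and $\operatorname{Im}P_{[0,\infty)}(A_x)$ are infinite-dimensional. Here $P_I(A)$ is the spectral projection of $A$ corresponding to the interval $I$. **Definitions.** A pair $(A,\varepsilon)$ with $\varepsilon>0$ is *enhanced* if $\pm\varepsilon\notin\sigma(A)$ and $P_{[-\varepsilon,\varepsilon]}(A)$ has finite rank. For a family $\mathbb A$ of self-adjoint operators and $U\subset X$, the pair $(U,\varepsilon)$ is *adapted* to $\mathbb A$ if $(A_x,\varepsilon)$ is enhanced for all $x\in U$ and both the finite-dimensional subspaces $V_x=\operatorname{Im}P_{[-\varepsilon,\varepsilon]}(A_x)$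 and the operators $V_x\to V_x$ induced by $A_x$ depend continuously on $x\in U$. The family $\mathbb A$ is *Fredholm* if every $A_x$ is Fredholm and $X$ is covered by open sets $U$ such that $(U,\varepsilon)$ is adapted to $\mathbb A$ for some $\varepsilon>0$; it is a *discrete-spectrum* family if $\mathbb A-\lambda=(A_x-\lambda)_{x\in X}$ is Fredholm for every $\lambda\in\mathbf R$. A local trivialization $t$ over an open set $U$ is *strictly adapted* to $\mathbb A$ if for some $\varepsilon>0$ the pair $(U,\varepsilon)$ is adapted to $\mathbb A$ and $x\mapsto t_x\,P_{[\varepsilon,\infty)}(A_x)\,t_x^{-1}$ is norm continuous on $U$. A Fredholm family $\mathbb A$ is *strictly Fredholm* if every point of $X$ lies in the domain of a strictly adapted local trivialization. For a strictly Fredholm family $\mathbb A$, the fiber of the bundle $\pi(\mathbb A)\colon\operatorname{Gr}(\mathbb A)\to X$ over $x$ is the set of closed subspaces $K\subset H_x$ commensurable with $\operatorname{Im}P_{[\varepsilon,\infty)}(A_x)$ (the intersection has finite codimension in both), where $(A_x,\varepsilon)$ is enhanced; this does not depend on $\varepsilon$. In strictly adapted local trivializations the topology of $\operatorname{Gr}(\mathbb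 A)$ is given by the topology of $X$ and the norm topology of the orthogonal projections onto the subspaces. A *weak spectral section* is a continuous section $\mathbb S$ of $\pi(\mathbb A)$. For $Y\subset X$, the restriction of $\mathbb S$ to $Y$ is a *spectral section* over $Y$ if there is a continuous function $r\colon Y\to\mathbf R_{>0}$ such that $$\operatorname{Im}P_{[r(y),\infty)}(A_y)\subset \mathbb S(y)\subset \operatorname{Im}P_{[-r(y),\infty)}(A_y)\qquad\text{for every } y\in Y;$$ $\mathbb S$ is a *spectral section* of $\mathbb A$ if this holds for $Y=X$. **Theorem.** Suppose that $\mathbb A$ is a discrete-spectrum and strictly Fredholm family. Then every weak spectral section $\mathbb S$ of $\mathbb A$ is homotopic, in the class of continuous sections of $\pi(\mathbb A)\colon\operatorname{Gr}(\mathbb A)\to X$, to a spectral section of $\mathbb A$. Moreover, if $Y\subset X$ is a subspace such that the restriction of $\mathbb S$ to $Y$ is a spectral section over $Y$, then there is a homotopy of this kind from $\mathbb S$ to a spectral section of $\mathbb A$ such that at every moment of the homotopy the restriction of the section to $Y$ is a spectral section over $Y$. -/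

import Mathlib

open Set Topology Bundle

noncomputable section

namespace GrassmannFamilies

/-! ### Unbounded operators in one Hilbert space -/

section Operators

variable {K : Type*} [NormedAddCommGroup K] [InnerProductSpace ℂ K]

/-- The operator `A - c`, with the same domain as `A`. -/
def shift (A : K →ₗ.[ℂ] K) (c : ℝ) : K →ₗ.[ℂ] K :=
  (-(c : ℂ) • (LinearMap.id : K →ₗ[ℂ] K)) +ᵥ A

/-- The spectrum of an unbounded operator: `z` is *not* in the spectrum iff `A - z` is a bijection
of the domain of `A` onto `K` whose inverse `R` is a bounded operator. -/
def opSpectrum (A : K →ₗ.[ℂ] K) : Set ℂ :=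
  {z | ¬ ∃ R : K →L[ℂ] K, ∀ u v : K, R u = v ↔ (v, u + z • v) ∈ A.graph}

/-- An (unbounded) Fredholm operator: the kernel is finite dimensional, the image is closed and
has finite codimension. -/
def IsFredholmOp (A : K →ₗ.[ℂ] K) : Prop :=
  FiniteDimensional ℂ (LinearMap.ker A.toFun) ∧
    IsClosed (LinearMap.range A.toFun : Set K) ∧
    FiniteDimensional ℂ (K ⧸ LinearMap.range A.toFun)

/-- Two closed subspaces are commensurable if their intersection has finite codimension in both. -/
def Commensurable (L M : ClosedSubmodule ℂ K) : Prop :=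
  FiniteDimensional ℂ (L.toSubmodule ⧸ (L.toSubmodule ⊓ M.toSubmodule).submoduleOf L.toSubmodule) ∧
  FiniteDimensional ℂ (M.toSubmodule ⧸ (L.toSubmodule ⊓ M.toSubmodule).submoduleOf M.toSubmodule)

variable [CompleteSpace K]

/-- The orthogonal projection of `K` onto a closed subspace. -/
def proj (L : ClosedSubmodule ℂ K) : K →L[ℂ] K := L.toSubmodule.starProjection

/-- A closed subspace `L` reduces `A` if the orthogonal projection `P` onto `L` commutes with `A`:
for `v` in the domain of `A`, also `P v` is in the domain and `A (P v) = P (A v)`. -/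
def Reduces (L : ClosedSubmodule ℂ K) (A : K →ₗ.[ℂ] K) : Prop :=
  ∀ v w : K, (v, w) ∈ A.graph → (proj L v, proj L w) ∈ A.graph

/-- The spectral subspace `Im P_I(A)` of a self-adjoint operator `A`, for a *closed interval* `I`
of the real line (bounded or not): the largest closed subspace which reduces `A` and on which the
quadratic form `⟨A v, v⟩` of `A` takes its values on unit vectors in `I`.

This is the image of the usual spectral projection: if `E` is the spectral measure of `A`, then
`Im E(I)` is such a subspace by the spectral theorem. Conversely, if `L` is such a subspace,
then `A` is the orthogonal sum of a self-adjoint operator in `L`, with spectrum contained in `I`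
since `I` is closed and convex, and a self-adjoint operator in `Lᗮ`; hence `L ⊆ Im E(I)`. -/
def spectralSubspace (A : K →ₗ.[ℂ] K) (I : Set ℝ) : ClosedSubmodule ℂ K :=
  sSup {L | Reduces L A ∧ ∀ v w : K, (v, w) ∈ A.graph → v ∈ L → ‖v‖ = 1 → (inner ℂ v w).re ∈ I}

/-- The spectral projection `P_I(A)` of a self-adjoint operator, for a closed interval `I`. -/
def spectralProj (A : K →ₗ.[ℂ] K) (I : Set ℝ) : K →L[ℂ] K := proj (spectralSubspace A I)

/-- `(A, ε)` is an enhanced operator. -/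
def Enhanced (A : K →ₗ.[ℂ] K) (ε : ℝ) : Prop :=
  0 < ε ∧ (ε : ℂ) ∉ opSpectrum A ∧ (-ε : ℂ) ∉ opSpectrum A ∧
    FiniteDimensional ℂ (spectralSubspace A (Icc (-ε) ε)).toSubmodule

/-- A self-adjoint Fredholm operator is essentially positive if its non-positive spectral subspace
is finite dimensional. -/
def EssentiallyPositive (A : K →ₗ.[ℂ] K) : Prop :=
  FiniteDimensional ℂ (spectralSubspace A (Iic 0)).toSubmodule

/-- A self-adjoint Fredholm operator is essentially negative if its non-negative spectral subspace
is finite dimensional. -/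
def EssentiallyNegative (A : K →ₗ.[ℂ] K) : Prop :=
  FiniteDimensional ℂ (spectralSubspace A (Ici 0)).toSubmodule

end Operators

/-! ### Hilbert bundles -/

section Bundles

variable {X : Type*} [TopologicalSpace X]
variable (H : Type*) [NormedAddCommGroup H] [InnerProductSpace ℂ H]
variable {E : X → Type*} [∀ x, NormedAddCommGroup (E x)] [∀ x, InnerProductSpace ℂ (E x)]

variable (E) in
/-- A local trivialization of a Hilbert bundle with fibers `E x` and model fiber `H`: a local
trivialization of the total space, over the open set `baseSet`, which is on every fiber an
isomorphism of Hilbert spaces. -/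
structure HilbertTriv [TopologicalSpace (TotalSpace H E)] extends
    Trivialization H (TotalSpace.proj : TotalSpace H E → X) where
  iso : ∀ x : baseSet, E x ≃ₗᵢ[ℂ] H
  iso_apply : ∀ (x : baseSet) (v : E x), toFun ⟨x, v⟩ = ((x : X), iso x v)

variable (E) in
/-- A locally trivial Hilbert bundle. Transition maps are only continuous as maps
`(U ∩ V) × H → H`, not in the operator norm. -/
class IsHilbertBundle [TopologicalSpace (TotalSpace H E)] : Prop where
  exists_triv : ∀ x : X, ∃ t : HilbertTriv H E, x ∈ t.baseSet

variable [TopologicalSpace (TotalSpace H E)]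

variable {H} in
/-- The operator in `H` which corresponds to an operator in the fiber over `x` under a local
trivialization. -/
def HilbertTriv.conj (t : HilbertTriv H E) (x : t.baseSet) (T : E x →L[ℂ] E x) : H →L[ℂ] H :=
  (t.iso x).toContinuousLinearEquiv.toContinuousLinearMap ∘L T ∘L
    (t.iso x).symm.toContinuousLinearEquiv.toContinuousLinearMap

/-- A family of bounded operators in the fibers over `U` is continuous if near every point of `U`
it is turned into a norm continuous family by some local trivialization. It is used only for
operators of finite rank, for which the choice of the local trivialization is irrelevant. -/
def ContinuousFamilyOn (T : ∀ x, E x →L[ℂ] E x) (U : Set X) : Prop :=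
  ∀ x ∈ U, ∃ t : HilbertTriv H E, x ∈ t.baseSet ∧
    Continuous fun y : (U ∩ t.baseSet : Set X) => t.conj ⟨y, y.2.2⟩ (T y)

variable [∀ x, CompleteSpace (E x)]

/-- The pair `(U, ε)` is adapted to the family `A`: for `x ∈ U` the pair `(A x, ε)` is an enhanced
operator, the finite dimensional subspaces `V x = Im P_{[-ε, ε]}(A x)` depend continuously on
`x ∈ U`, and so do the operators `V x → V x` induced by `A x`
(encoded as the finite rank operators `B x = A x ∘ P_{[-ε, ε]}(A x)`). -/
def Adapted (A : ∀ x, E x →ₗ.[ℂ] E x) (U : Set X) (ε : ℝ) : Prop :=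
  (∀ x ∈ U, Enhanced (A x) ε) ∧
  ContinuousFamilyOn H (fun x => spectralProj (A x) (Icc (-ε) ε)) U ∧
  ∃ B : ∀ x, E x →L[ℂ] E x,
    (∀ x ∈ U, ∀ v : E x, (spectralProj (A x) (Icc (-ε) ε) v, B x v) ∈ (A x).graph) ∧
    ContinuousFamilyOn H B U

/-- Fredholm families of self-adjoint operators. -/
def IsFredholmFamily (A : ∀ x, E x →ₗ.[ℂ] E x) : Prop :=
  (∀ x, IsFredholmOp (A x)) ∧
  ∀ x, ∃ (U : Set X) (ε : ℝ), IsOpen U ∧ x ∈ U ∧ Adapted H A U ε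

/-- Discrete-spectrum families: `A - c` is a Fredholm family for every real `c`. -/
def IsDiscreteSpectrumFamily (A : ∀ x, E x →ₗ.[ℂ] E x) : Prop :=
  ∀ c : ℝ, IsFredholmFamily H fun x => shift (A x) c

variable {H} in
/-- A local trivialization, defined over `U`, is strictly adapted to `A` if for some `ε` the pair
`(U, ε)` is adapted to `A` and the projections `P_{[ε, ∞)}(A x)`, `x ∈ U`, are turned by the
trivialization into a norm continuous family. -/
def HilbertTriv.StrictlyAdapted (t : HilbertTriv H E) (A : ∀ x, E x →ₗ.[ℂ] E x) : Prop :=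
  ∃ ε : ℝ, Adapted H A t.baseSet ε ∧
    Continuous fun x : t.baseSet => t.conj x (spectralProj (A x) (Ici ε))

/-- Strictly Fredholm families. -/
def IsStrictlyFredholmFamily (A : ∀ x, E x →ₗ.[ℂ] E x) : Prop :=
  IsFredholmFamily H A ∧
  ∀ x, ∃ t : HilbertTriv H E, x ∈ t.baseSet ∧ t.StrictlyAdapted A

/-! ### The Grassmannian bundle and its sections -/

/-- The total space of the Grassmannian bundle of `A`: pairs of a point `x` of `X` and a closed
subspace of the fiber over `x`, commensurable with `Im P_{[ε, ∞)}(A x)` for some `ε` such that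
`(A x, ε)` is an enhanced operator. -/
@[nolint unusedArguments]
structure Gr (_H : Type*) (A : ∀ x, E x →ₗ.[ℂ] E x) where
  base : X
  space : ClosedSubmodule ℂ (E base)
  commensurable : ∃ ε : ℝ, Enhanced (A base) ε ∧
    Commensurable space (spectralSubspace (A base) (Ici ε))

/-- The part of the total space of the Grassmannian bundle over the domain of `t`. -/
def Gr.Over (A : ∀ x, E x →ₗ.[ℂ] E x) (t : HilbertTriv H E) : Type _ :=
  {p : Gr H A // p.base ∈ t.baseSet}

/-- A local trivialization identifies closed subspaces of the fibers with closed subspaces of `H`,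
and the latter with the orthogonal projections onto them. -/
def Gr.chart (A : ∀ x, E x →ₗ.[ℂ] E x) (t : HilbertTriv H E) (p : Gr.Over H A t) :
    t.baseSet × (H →L[ℂ] H) :=
  (⟨p.1.base, p.2⟩, t.conj ⟨p.1.base, p.2⟩ (proj p.1.space))

/-- The topology of the total space of the Grassmannian bundle: over the domain `U` of a strictly
adapted local trivialization it is the topology of `U` times the norm topology of orthogonal
projections; a set is open if all its parts over such domains are open. -/
instance (A : ∀ x, E x →ₗ.[ℂ] E x) : TopologicalSpace (Gr H A) :=
  ⨆ t : {t : HilbertTriv H E // t.StrictlyAdapted A},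
    TopologicalSpace.coinduced (Subtype.val : Gr.Over H A t.1 → Gr H A)
      (TopologicalSpace.induced (Gr.chart H A t.1) inferInstance)

variable {H} {A : ∀ x, E x →ₗ.[ℂ] E x}

/-- A weak spectral section of `A` is a continuous section of the Grassmannian bundle of `A`. -/
def IsWeakSpectralSection (S : C(X, Gr H A)) : Prop := ∀ x, (S x).base = x

/-- The restriction of the section `S` to `Y` is a spectral section of the family `A y`, `y ∈ Y`:
there is a continuous function `r : Y → ℝ_{>0}` with
`Im P_{[r(y), ∞)}(A y) ⊆ S y ⊆ Im P_{[-r(y), ∞)}(A y)` for every `y ∈ Y`. -/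
def IsSpectralSectionOn (S : C(X, Gr H A)) (Y : Set X) : Prop :=
  IsWeakSpectralSection S ∧
  ∃ r : C(Y, ℝ), ∀ y : Y, 0 < r y ∧
    spectralSubspace (A (S y).base) (Ici (r y)) ≤ (S y).space ∧
    (S y).space ≤ spectralSubspace (A (S y).base) (Ici (-r y))

/-- Spectral sections of `A`. -/
def IsSpectralSection (S : C(X, Gr H A)) : Prop := IsSpectralSectionOn S univ

end Bundles

end GrassmannFamilies

end

open GrassmannFamilies

open Set Topology Bundle

noncomputable section

set_option linter.unusedSectionVars false

/-! Let `P y` be the orthogonal projection onto the subspace chosen by `S` at `y`. The plan is to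
deform `P` within self-adjoint operators close to projections, and to turn these back into
projections by functional calculus.

The target of the deformation is a family `T y` of self-adjoint operators with `T y - P y` small and
of finite rank (`nearby`), such that `T y` is the identity on eigenvectors of `A y` with eigenvalue
at least `r y` and zero on those with eigenvalue below `-r y` (`blocks`). Near a point, write `P = F
+ P_{[ε, ∞)}(A)` with `F` of finite rank, and put `T = Q F Q + P_{[ε, ∞)}(A)`, where `Q` is the
spectral projection of a large bounded set. Since the eigenvectors of `A` are total, `Q` is strongly
close to the identity, hence `Q F Q` is close to `F` in norm (`exists_local_block`). Both conditions
on `T` are convex, unlike the condition of being a projection, so a partition of unity gives a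
global `T` (`exists_global_block`).

The spectrum of each `(1 - s) P + s T` stays near `0` and `1`, so `cutoff` maps it to a projection
commensurable with `P`. This path starts at `S`, and at `s = 1` the block form of `T` gives the
spectral inclusions. Over `Y` both `P` and `T` have block form for a common `r`, hence so does the
whole segment.

Two facts support this. Discreteness of the spectrum is first extracted from the Fredholm
conditions: the resolvent is compact (`IsResolvent.isCompactOperator`), after which identities
between spectral projections are checked on eigenvectors. Norm continuity is independent of the
strictly adapted trivialization, although transition maps are only strongly continuous, because the
operators compared differ by finite rank (`tendsto_ext_of_strictlyAdapted`). -/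

namespace GrassmannFamilies

/-! ### Eigenspaces and resolvents of one self-adjoint operator. -/

section SingleOperator

variable {K : Type*} [NormedAddCommGroup K] [InnerProductSpace ℂ K]

lemma mem_graph_shift {A : K →ₗ.[ℂ] K} {c : ℝ} {v w : K} :
    (v, w) ∈ (shift A c).graph ↔ (v, w + (c : ℂ) • v) ∈ A.graph := by
  simp only [LinearPMap.mem_graph_iff]
  constructor
  · rintro ⟨y, rfl, hy⟩
    refine ⟨y, rfl, ?_⟩
    rw [← hy]
    show A y = (-(c : ℂ) • (y : K) + A y) + _
    simp
  · rintro ⟨y, rfl, hy⟩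
    refine ⟨y, rfl, ?_⟩
    show (-(c : ℂ) • (y : K) + A y) = _
    rw [hy]
    simp

/-- The eigenspace of an unbounded operator for a real eigenvalue. -/
def eig (A : K →ₗ.[ℂ] K) (c : ℝ) : Submodule ℂ K where
  carrier := {v | (v, (c : ℂ) • v) ∈ A.graph}
  add_mem' {v w} hv hw := by
    have := A.graph.add_mem hv hw
    rwa [Prod.mk_add_mk, ← smul_add] at this
  zero_mem' := by
    have := A.graph.zero_mem
    rwa [mem_ofPred_eq, smul_zero]
  smul_mem' a v hv := by
    have := A.graph.smul_mem a hv
    rwa [Prod.smul_mk, smul_comm] at this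

lemma mem_eig {A : K →ₗ.[ℂ] K} {c : ℝ} {v : K} : v ∈ eig A c ↔ (v, (c : ℂ) • v) ∈ A.graph :=
  Iff.rfl

lemma eq_of_mem_graph {A : K →ₗ.[ℂ] K} {v w w' : K} (h : (v, w) ∈ A.graph)
    (h' : (v, w') ∈ A.graph) : w = w' := by
  have := A.graph.sub_mem h h'
  rw [Prod.mk_sub_mk, sub_self] at this
  exact sub_eq_zero.1 (A.graph_fst_eq_zero_snd this rfl)

variable [CompleteSpace K]

lemma inner_graph_symm {A : K →ₗ.[ℂ] K} (hA : IsSelfAdjoint A) {v w v' w' : K}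
    (h : (v, w) ∈ A.graph) (h' : (v', w') ∈ A.graph) : inner ℂ w v' = inner ℂ v w' := by
  have := LinearPMap.adjoint_isFormalAdjoint hA.dense_domain
  rw [(LinearPMap.isSelfAdjoint_def.1 hA : A.adjoint = A)] at this
  rw [LinearPMap.mem_graph_iff] at h h'
  obtain ⟨y, rfl, rfl⟩ := h
  obtain ⟨y', rfl, rfl⟩ := h'
  exact this y y'

/-- `R` is the resolvent `(A - c)⁻¹`. -/
def IsResolvent (A : K →ₗ.[ℂ] K) (c : ℝ) (R : K →L[ℂ] K) : Prop :=
  ∀ u v : K, R u = v ↔ (v, u + (c : ℂ) • v) ∈ A.graph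

lemma exists_isResolvent {A : K →ₗ.[ℂ] K} {c ε : ℝ} (h : Enhanced (shift A c) ε) :
    ∃ (d : ℝ) (R : K →L[ℂ] K), IsResolvent A d R := by
  have h1 := h.2.1
  simp only [opSpectrum, mem_ofPred_eq, not_not] at h1
  obtain ⟨R, hR⟩ := h1
  refine ⟨ε + c, R, fun u v => ?_⟩
  rw [hR, mem_graph_shift, add_assoc, ← add_smul]
  push_cast
  rfl

namespace IsResolvent

variable {A : K →ₗ.[ℂ] K} {d : ℝ} {R : K →L[ℂ] K}

lemma mem_graph (hR : IsResolvent A d R) (u : K) : (R u, u + (d : ℂ) • R u) ∈ A.graph :=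
  (hR u _).1 rfl

lemma apply_of_mem_graph (hR : IsResolvent A d R) {v w : K} (h : (v, w) ∈ A.graph) :
    R (w - (d : ℂ) • v) = v := by
  rw [hR]; simpa using h

lemma injective (hR : IsResolvent A d R) {u : K} (hu : R u = 0) : u = 0 := by
  have := hR.mem_graph u
  rw [hu, smul_zero, add_zero] at this
  exact A.graph_fst_eq_zero_snd this rfl

lemma isSelfAdjoint (hR : IsResolvent A d R) (hA : IsSelfAdjoint A) : IsSelfAdjoint R := by
  rw [ContinuousLinearMap.isSelfAdjoint_iff_isSymmetric]
  intro u u'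
  have := inner_graph_symm hA (hR.mem_graph u) (hR.mem_graph u')
  simp only [inner_add_left, inner_add_right, inner_smul_left, inner_smul_right,
    Complex.conj_ofReal] at this
  exact (add_right_cancel this).symm

/-- Trades commutation with an unbounded operator, and its domain conditions, for commutation with
the bounded `R`. -/
lemma reduces_iff (hR : IsResolvent A d R) (L : ClosedSubmodule ℂ K) :
    Reduces L A ↔ ∀ u, R (proj L u) = proj L (R u) := by
  constructor
  · intro h u
    have := h _ _ (hR.mem_graph u)
    rw [hR]
    simpa using this
  · intro h v w hvw
    have := hR.apply_of_mem_graph hvw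
    have h2 := h (w - (d : ℂ) • v)
    rw [this, hR] at h2
    simpa using h2

lemma mem_eig_of_apply_eq (hR : IsResolvent A d R) {μ : ℝ} (hμ : μ ≠ 0) {v : K}
    (h : R v = (μ : ℂ) • v) : v ∈ eig A (μ⁻¹ + d) := by
  have hc : (μ : ℂ) ≠ 0 := by exact_mod_cast hμ
  have := A.graph.smul_mem (μ : ℂ)⁻¹ (hR.mem_graph v)
  rw [h, Prod.smul_mk, smul_smul, inv_mul_cancel₀ hc, one_smul] at this
  rw [mem_eig]
  convert this using 2
  rw [smul_add, smul_comm (μ : ℂ)⁻¹, smul_smul (μ : ℂ)⁻¹, inv_mul_cancel₀ hc, one_smul]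
  push_cast
  rw [add_smul]

end IsResolvent

end SingleOperator

/-! ### Finite rank operators and orthogonal projections. -/

section FiniteRank

variable {K : Type*} [NormedAddCommGroup K] [InnerProductSpace ℂ K]

/-- Bounded operators with a finite dimensional image. -/
def IsFiniteRank (T : K →L[ℂ] K) : Prop := FiniteDimensional ℂ (LinearMap.range T.toLinearMap)

namespace IsFiniteRank

lemma of_le {T : K →L[ℂ] K} {V : Submodule ℂ K} [FiniteDimensional ℂ V] (h : ∀ v, T v ∈ V) :
    IsFiniteRank T := by
  have : LinearMap.range T.toLinearMap ≤ V := by rintro _ ⟨v, rfl⟩; exact h v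
  exact Submodule.finiteDimensional_of_le this

lemma zero : IsFiniteRank (0 : K →L[ℂ] K) :=
  of_le (V := ⊥) fun v => by simp

lemma add {S T : K →L[ℂ] K} (hS : IsFiniteRank S) (hT : IsFiniteRank T) : IsFiniteRank (S + T) := by
  unfold IsFiniteRank at hS hT
  exact of_le (V := LinearMap.range S.toLinearMap ⊔ LinearMap.range T.toLinearMap) fun v =>
    Submodule.add_mem_sup ⟨v, rfl⟩ ⟨v, rfl⟩

lemma mul_left {T : K →L[ℂ] K} (S : K →L[ℂ] K) (hT : IsFiniteRank T) : IsFiniteRank (S * T) := by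
  unfold IsFiniteRank at hT
  exact of_le (V := (LinearMap.range T.toLinearMap).map S.toLinearMap) fun v =>
    ⟨T v, ⟨v, rfl⟩, rfl⟩

lemma mul_right {T : K →L[ℂ] K} (hT : IsFiniteRank T) (S : K →L[ℂ] K) : IsFiniteRank (T * S) := by
  unfold IsFiniteRank at hT
  exact of_le (V := LinearMap.range T.toLinearMap) fun v => ⟨S v, rfl⟩

lemma neg {T : K →L[ℂ] K} (hT : IsFiniteRank T) : IsFiniteRank (-T) := by
  simpa using hT.mul_left (-1)

lemma sub {S T : K →L[ℂ] K} (hS : IsFiniteRank S) (hT : IsFiniteRank T) : IsFiniteRank (S - T) := by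
  rw [sub_eq_add_neg]; exact hS.add hT.neg

lemma smul {T : K →L[ℂ] K} (a : ℝ) (hT : IsFiniteRank T) : IsFiniteRank (a • T) := by
  unfold IsFiniteRank at hT
  refine of_le (V := LinearMap.range T.toLinearMap) fun v => ?_
  have : (a • T) v = (a : ℂ) • T v := rfl
  rw [this]
  exact Submodule.smul_mem _ _ ⟨v, rfl⟩

lemma isCompactOperator {T : K →L[ℂ] K} (hT : IsFiniteRank T) : IsCompactOperator T := by
  unfold IsFiniteRank at hT
  let V := LinearMap.range T.toLinearMap
  have : LocallyCompactSpace V := .of_finiteDimensional_of_complete ℂ V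
  have h : IsCompactOperator (T.codRestrict V fun v => ⟨v, rfl⟩) :=
    isCompactOperator_of_locallyCompactSpace_dom _
  exact h.clm_comp V.subtypeL

end IsFiniteRank

variable [CompleteSpace K]

lemma IsFiniteRank.proj {L : ClosedSubmodule ℂ K} (h : FiniteDimensional ℂ L.toSubmodule) :
    IsFiniteRank (proj L) :=
  .of_le (V := L.toSubmodule) fun v => Submodule.starProjection_apply_mem _ v

lemma proj_mem (L : ClosedSubmodule ℂ K) (v : K) : proj L v ∈ L :=
  Submodule.starProjection_apply_mem L.toSubmodule v

lemma proj_eq_self_iff {L : ClosedSubmodule ℂ K} {v : K} : proj L v = v ↔ v ∈ L :=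
  Submodule.starProjection_eq_self_iff

lemma proj_isSelfAdjoint (L : ClosedSubmodule ℂ K) : IsSelfAdjoint (proj L) :=
  isSelfAdjoint_starProjection L.toSubmodule

lemma proj_mul_self (L : ClosedSubmodule ℂ K) : proj L * proj L = proj L := by
  ext v
  exact proj_eq_self_iff.2 (proj_mem L v)

lemma proj_eq_zero_iff {L : ClosedSubmodule ℂ K} {v : K} :
    proj L v = 0 ↔ ∀ u ∈ L, inner ℂ u v = 0 :=
  (Submodule.starProjection_apply_eq_zero_iff L.toSubmodule).trans (Submodule.mem_orthogonal _ _)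

lemma norm_proj_le (L : ClosedSubmodule ℂ K) : ‖proj L‖ ≤ 1 :=
  Submodule.starProjection_norm_le L.toSubmodule

lemma inner_apply_left {R : K →L[ℂ] K} (hR : IsSelfAdjoint R) (u v : K) :
    inner ℂ (R u) v = inner ℂ u (R v) :=
  ContinuousLinearMap.isSelfAdjoint_iff_isSymmetric.1 hR u v

lemma proj_apply_comm {L : ClosedSubmodule ℂ K} {R : K →L[ℂ] K} (hR : IsSelfAdjoint R)
    (h : ∀ v ∈ L, R v ∈ L) (u : K) : R (proj L u) = proj L (R u) := by
  refine (Submodule.eq_starProjection_of_mem_orthogonal (h _ (proj_mem L u)) ?_).symm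
  rw [← map_sub, Submodule.mem_orthogonal]
  intro v hv
  rw [← inner_apply_left hR]
  have := Submodule.sub_starProjection_mem_orthogonal (K := L.toSubmodule) u
  exact (Submodule.mem_orthogonal _ _).1 this _ (h v hv)

end FiniteRank

/-! ### Compactness of the resolvent and totality of eigenvectors. -/

section Spectrum

variable {K : Type*} [NormedAddCommGroup K] [InnerProductSpace ℂ K] [CompleteSpace K]

/-- Operators with purely discrete spectrum. -/
def HasDiscreteSpectrum (A : K →ₗ.[ℂ] K) : Prop := ∀ c : ℝ, ∃ ε, Enhanced (shift A c) ε

/-- The squared norm of `k(R) v` equals `⟨v, k²(R) v⟩`, and the functional calculus is monotone. -/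
lemma norm_cfc_apply_le {R : K →L[ℂ] K} (hR : IsSelfAdjoint R) {f g : ℝ → ℝ} (hf : Continuous f)
    (hg : Continuous g) (h : ∀ t, |f t| ≤ |g t|) (v : K) : ‖cfc f R v‖ ≤ ‖cfc g R v‖ := by
  have key : ∀ k : ℝ → ℝ, Continuous k →
      ‖cfc k R v‖ ^ 2 = (inner ℂ v (cfc (fun t => k t ^ 2) R v)).re := by
    intro k hk
    have hs : IsSelfAdjoint (cfc k R) := cfc_predicate k R
    rw [cfc_pow _ _ _ (hk.continuousOn), pow_two (cfc k R), mul_apply_eq_comp,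
      ← inner_apply_left hs]
    exact (inner_self_eq_norm_sq (𝕜 := ℂ) _).symm
  have hle : cfc (fun t => f t ^ 2) R ≤ cfc (fun t => g t ^ 2) R :=
    cfc_mono (fun t _ => sq_le_sq.2 (h t)) (by fun_prop) (by fun_prop)
  rw [ContinuousLinearMap.le_def] at hle
  have h2 := hle.re_inner_nonneg_right v
  rw [sub_apply, inner_sub_right, map_sub] at h2
  have : ‖cfc f R v‖ ^ 2 ≤ ‖cfc g R v‖ ^ 2 := by
    rw [key f hf, key g hg]
    exact sub_nonneg.1 h2
  exact le_of_sq_le_sq this (norm_nonneg _)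

namespace IsResolvent

variable {A : K →ₗ.[ℂ] K} {d : ℝ} {R : K →L[ℂ] K}

/-- The function vanishes unless `|1 - s / t| < ε |s|`, that is, unless the point `1 / s + d`
corresponding to `s` lies within `ε` of `1 / t + d`. So the image of the operator lies in the
spectral subspace of the window `[-ε, ε]` of the shifted `A`, which is finite dimensional. -/
lemma isFiniteRank_cfc (hR : IsResolvent A d R) (hA : IsSelfAdjoint A) {t ε : ℝ}
    (h : Enhanced (shift A (t⁻¹ + d)) ε) :
    IsFiniteRank (cfc (fun s : ℝ => max 0 (ε * |s| - |1 - t⁻¹ * s|)) R) := by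
  have hRs := hR.isSelfAdjoint hA
  set f : ℝ → ℝ := fun s : ℝ => max 0 (ε * |s| - |1 - t⁻¹ * s|) with hf
  have hfc : Continuous f := by fun_prop
  set G := cfc f R with hG
  let M : ClosedSubmodule ℂ K := (LinearMap.range G.toLinearMap).closure
  have hGM : ∀ z, G z ∈ M := fun z => subset_closure ⟨z, rfl⟩
  have hind : ∀ {p : K → Prop}, IsClosed {u | p u} → (∀ z, p (G z)) → ∀ u ∈ M, p u := by
    intro p hp hz u hu
    have : (M : Set K) ⊆ {u | p u} := closure_minimal (by rintro _ ⟨z, rfl⟩; exact hz z) hp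
    exact this hu
  have hcomm : ∀ z, R (G z) = G (R z) := fun z => by
    have hc := (cfc_commute_cfc id f R).eq
    rw [cfc_id ℝ R] at hc
    exact congrArg (fun T : K →L[ℂ] K => T z) hc
  have hRM : ∀ u ∈ M, R u ∈ M := by
    refine hind (M.isClosed.preimage R.continuous) fun z => ?_
    rw [hcomm]; exact hGM _
  -- With `v = R u` this says that the shifted operator has norm at most `ε` on `v`, which bounds
  -- its quadratic form on `M`.
  have hbound : ∀ u ∈ M, ‖u - ((t⁻¹ : ℝ) : ℂ) • R u‖ ≤ ε * ‖R u‖ := by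
    refine hind (isClosed_le (by fun_prop) (by fun_prop)) fun z => ?_
    have e1 : G z - ((t⁻¹ : ℝ) : ℂ) • R (G z) = cfc (fun s => (1 - t⁻¹ * s) * f s) R z := by
      rw [cfc_mul _ _ R (by fun_prop) (by fun_prop), cfc_sub _ _ R (by fun_prop) (by fun_prop),
        cfc_const_mul _ _ R (by fun_prop), cfc_const_one ℝ R, cfc_id' ℝ R]
      rfl
    have e2 : R (G z) = cfc (fun s => s * f s) R z := by
      rw [cfc_mul _ _ R (by fun_prop) (by fun_prop), cfc_id' ℝ R]
      rfl
    have e3 : ε * ‖R (G z)‖ = ‖cfc (fun s => ε * (s * f s)) R z‖ := by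
      rw [cfc_const_mul _ _ R (by fun_prop), e2]
      have : (ε • cfc (fun s => s * f s) R) z = (ε : ℂ) • cfc (fun s => s * f s) R z := rfl
      rw [this, norm_smul, Complex.norm_real, Real.norm_of_nonneg h.1.le]
    rw [e3, e1]
    refine norm_cfc_apply_le hRs (by fun_prop) (by fun_prop) (fun s => ?_) z
    rw [abs_mul, abs_mul, abs_mul, ← mul_assoc, abs_of_pos h.1]
    rcases le_or_gt (ε * |s| - |1 - t⁻¹ * s|) 0 with hs | hs
    · have : f s = 0 := max_eq_left hs
      simp [this]
    · gcongr
      linarith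
  have hred : Reduces M (shift A (t⁻¹ + d)) := by
    have h1 := (hR.reduces_iff M).2 (proj_apply_comm hRs hRM)
    intro v w hvw
    rw [mem_graph_shift] at hvw ⊢
    simpa using h1 _ _ hvw
  have hle : M ≤ spectralSubspace (shift A (t⁻¹ + d)) (Icc (-ε) ε) := by
    refine le_sSup ⟨hred, fun v w hvw hv hv1 => ?_⟩
    rw [mem_graph_shift] at hvw
    have h1 := hR.apply_of_mem_graph hvw
    set u := w + ((t⁻¹ + d : ℝ) : ℂ) • v - (d : ℂ) • v with hu
    -- Here `u = (A - d) v`. Since `R` is injective and commutes with the projection onto `M`,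
    -- membership of `v = R u` in `M` forces that of `u`.
    have huM : u ∈ M := by
      rw [← proj_eq_self_iff, ← sub_eq_zero]
      apply hR.injective
      rw [map_sub, proj_apply_comm hRs hRM, h1, proj_eq_self_iff.2 hv, sub_self]
    have h2 := hbound u huM
    have h3 : u - ((t⁻¹ : ℝ) : ℂ) • R u = w := by
      rw [h1, hu]; push_cast; module
    rw [h3, h1, hv1, mul_one] at h2
    have h4 : |(inner ℂ v w).re| ≤ ε := by
      refine (Complex.abs_re_le_norm _).trans ((norm_inner_le_norm v w).trans ?_)
      rwa [hv1, one_mul]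
    exact abs_le.1 h4
  have := h.2.2.2
  exact .of_le (V := (spectralSubspace (shift A (t⁻¹ + d)) (Icc (-ε) ε)).toSubmodule)
    fun v => hle (hGM v)

/-- The continuous `f` on the spectrum with `f(R)` compact form a closed ideal, which is determined
by its common zeros. At every `t ≠ 0` the bump function of `isFiniteRank_cfc` belongs to the ideal
and does not vanish, so the identity function, which vanishes only at `0`, belongs to it too. -/
lemma isCompactOperator (hR : IsResolvent A d R) (hA : IsSelfAdjoint A)
    (hd : HasDiscreteSpectrum A) : IsCompactOperator R := by
  have hRs := hR.isSelfAdjoint hA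
  let φ := cfcHom (R := ℝ) hRs
  let J : Ideal C(spectrum ℝ R, ℝ) :=
    { carrier := {f | IsCompactOperator (φ f)}
      add_mem' := fun {f g} hf hg => by
        simp only [mem_ofPred_eq, map_add] at *
        exact hf.add hg
      zero_mem' := by
        simp only [mem_ofPred_eq, map_zero]
        exact isCompactOperator_zero
      smul_mem' := fun c f hf => by
        simp only [mem_ofPred_eq, smul_eq_mul, map_mul] at *
        exact IsCompactOperator.clm_comp hf _ }
  have hJ : IsClosed (J : Set C(spectrum ℝ R, ℝ)) :=
    (isClosed_setOfPred_isCompactOperator (𝕜₁ := ℂ) (𝕜₂ := ℂ) (σ₁₂ := RingHom.id ℂ)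
      (M₁ := K) (M₂ := K)).preimage (cfcHom_continuous hRs)
  have hid : ContinuousMap.restrict (spectrum ℝ R) (ContinuousMap.id ℝ) ∈ J := by
    rw [← ContinuousMap.idealOfSet_ofIdeal_isClosed hJ, ContinuousMap.mem_idealOfSet]
    rintro ⟨t, ht⟩ htJ
    rw [mem_compl_iff, ContinuousMap.mem_setOfIdeal] at htJ
    push Not at htJ
    show t = 0
    by_contra h0
    obtain ⟨ε, hε⟩ := hd (t⁻¹ + d)
    have h1 := hR.isFiniteRank_cfc hA hε
    have h2 := htJ (ContinuousMap.restrict (spectrum ℝ R)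
      ⟨fun s : ℝ => max 0 (ε * |s| - |1 - t⁻¹ * s|), by fun_prop⟩)
    have h3 := h1.isCompactOperator
    rw [cfc_apply _ _ hRs (by fun_prop)] at h3
    have h4 := h2 h3
    simp only [ContinuousMap.restrict_apply, ContinuousMap.coe_mk, inv_mul_cancel₀ h0, sub_self,
      abs_zero, sub_zero] at h4
    have : 0 < ε * |t| := mul_pos hε.1 (abs_pos.2 h0)
    exact absurd (max_eq_left_iff.1 h4) (not_le.2 this)
  have : IsCompactOperator (φ (ContinuousMap.restrict (spectrum ℝ R) (ContinuousMap.id ℝ))) := hid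
  rwa [cfcHom_id hRs] at this

end IsResolvent

/-- Eigenvectors of a self-adjoint operator with discrete spectrum are total. -/
lemma HasDiscreteSpectrum.eq_zero {A : K →ₗ.[ℂ] K} (hd : HasDiscreteSpectrum A)
    (hA : IsSelfAdjoint A) {v : K} (hv : ∀ c, ∀ u ∈ eig A c, inner ℂ u v = 0) : v = 0 := by
  obtain ⟨ε, hε⟩ := hd 0
  obtain ⟨d, R, hR⟩ := exists_isResolvent hε
  have hs := ContinuousLinearMap.isSelfAdjoint_iff_isSymmetric.1 (hR.isSelfAdjoint hA)
  have h := ContinuousLinearMap.orthogonalComplement_iSup_eigenspaces_eq_bot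
    (hR.isCompactOperator hA hd) hs
  have : v ∈ (⨆ μ, Module.End.eigenspace (R : K →ₗ[ℂ] K) μ)ᗮ := by
    rw [← Submodule.iInf_orthogonal, Submodule.mem_iInf]
    intro μ
    rw [Submodule.mem_orthogonal]
    intro u hu
    by_cases hu0 : u = 0
    · simp [hu0]
    have hreal := hs.conj_eigenvalue_eq_self
      (Module.End.hasEigenvalue_of_hasEigenvector ⟨hu, hu0⟩)
    obtain ⟨m, rfl⟩ := Complex.conj_eq_iff_real.1 hreal
    rw [Module.End.mem_eigenspace_iff] at hu
    refine hv (m⁻¹ + d) u (hR.mem_eig_of_apply_eq ?_ hu)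
    rintro rfl
    exact hu0 (hR.injective (by simpa using hu))
  rw [h] at this
  simpa using this

end Spectrum

/-! ### Spectral subspaces described by eigenvectors. -/

section SpectralSubspaces

variable {K : Type*} [NormedAddCommGroup K] [InnerProductSpace ℂ K] [CompleteSpace K]

/-- It suffices to treat each reducing `L` in the supremum. The projection of `u` to `L` is again in
the eigenspace, and if it were nonzero its normalization would give the quadratic form the value `c
∉ I`. -/
lemma inner_eq_zero_of_mem_spectralSubspace {A : K →ₗ.[ℂ] K} {I : Set ℝ} {c : ℝ} (hc : c ∉ I)
    {u v : K} (hu : u ∈ eig A c) (hv : v ∈ spectralSubspace A I) : inner ℂ u v = 0 := by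
  let N : ClosedSubmodule ℂ K := ⟨(eig A c)ᗮ, Submodule.isClosed_orthogonal _⟩
  suffices h : spectralSubspace A I ≤ N from (Submodule.mem_orthogonal _ _).1 (h hv) u hu
  refine sSup_le fun L hL v hv => (Submodule.mem_orthogonal _ _).2 fun u hu => ?_
  have h1 : proj L u ∈ eig A c := by
    have := hL.1 _ _ hu
    rwa [map_smul] at this
  have h2 : proj L u = 0 := by
    by_contra h0
    have hn : (‖proj L u‖ : ℂ) ≠ 0 := by exact_mod_cast norm_ne_zero_iff.2 h0
    set e := (‖proj L u‖ : ℂ)⁻¹ • proj L u with he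
    have he1 : ‖e‖ = 1 := by
      rw [he, norm_smul, norm_inv, Complex.norm_real, norm_norm]
      exact inv_mul_cancel₀ (norm_ne_zero_iff.2 h0)
    have he2 : e ∈ eig A c := Submodule.smul_mem _ _ h1
    have he3 : e ∈ L := L.toSubmodule.smul_mem _ (proj_mem L u)
    have h3 := hL.2 e _ he2 he3 he1
    rw [inner_smul_right, inner_self_eq_norm_sq_to_K, he1] at h3
    exact hc (by simpa using h3)
  rw [← proj_eq_self_iff.2 hv, ← inner_apply_left (proj_isSelfAdjoint L), h2, inner_zero_left]

lemma isClosed_eig {A : K →ₗ.[ℂ] K} (hA : IsSelfAdjoint A) (c : ℝ) :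
    IsClosed (eig A c : Set K) :=
  hA.isClosed.preimage (f := fun v : K => (v, (c : ℂ) • v)) (by fun_prop)

/-- The eigenspace is itself one of the subspaces in the supremum: it is closed, invariant under the
self-adjoint `R`, and the quadratic form on its unit vectors is `c`. -/
lemma IsResolvent.eig_le_spectralSubspace {A : K →ₗ.[ℂ] K} {d : ℝ} {R : K →L[ℂ] K}
    (hR : IsResolvent A d R) (hA : IsSelfAdjoint A) {I : Set ℝ} {c : ℝ} (hc : c ∈ I) :
    eig A c ≤ (spectralSubspace A I).toSubmodule := by
  let N : ClosedSubmodule ℂ K := ⟨eig A c, isClosed_eig hA c⟩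
  have hRN : ∀ v ∈ N, R v ∈ N := by
    intro v hv
    have h1 := hR.apply_of_mem_graph (mem_eig.1 hv)
    show R v ∈ eig A c
    have h2 : R (((c : ℂ) - d) • R v) = R v := by
      rw [map_smul, ← map_smul, ← map_smul, sub_smul, h1]
    rw [hR] at h2
    rw [mem_eig]
    convert h2 using 2
    module
  suffices h : N ≤ spectralSubspace A I from h
  refine le_sSup ⟨(hR.reduces_iff N).2 (proj_apply_comm (hR.isSelfAdjoint hA) hRN), ?_⟩
  intro v w hvw hv hv1
  rw [eq_of_mem_graph hvw hv, inner_smul_right, inner_self_eq_norm_sq_to_K, hv1]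
  simpa using hc

variable {A : K →ₗ.[ℂ] K}

namespace HasDiscreteSpectrum

lemma eig_le_spectralSubspace (hd : HasDiscreteSpectrum A) (hA : IsSelfAdjoint A) {I : Set ℝ}
    {c : ℝ} (hc : c ∈ I) : eig A c ≤ (spectralSubspace A I).toSubmodule := by
  obtain ⟨ε, hε⟩ := hd 0
  obtain ⟨d, R, hR⟩ := exists_isResolvent hε
  exact hR.eig_le_spectralSubspace hA hc

lemma spectralProj_apply_of_mem (hd : HasDiscreteSpectrum A) (hA : IsSelfAdjoint A) {I : Set ℝ}
    {c : ℝ} (hc : c ∈ I) {v : K} (hv : v ∈ eig A c) : spectralProj A I v = v :=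
  proj_eq_self_iff.2 (hd.eig_le_spectralSubspace hA hc hv)

end HasDiscreteSpectrum

lemma spectralProj_apply_of_notMem {I : Set ℝ} {c : ℝ} (hc : c ∉ I) {v : K} (hv : v ∈ eig A c) :
    spectralProj A I v = 0 :=
  proj_eq_zero_iff.2 fun u hu => by
    rw [← inner_conj_symm, inner_eq_zero_of_mem_spectralSubspace hc hv hu, map_zero]

namespace HasDiscreteSpectrum

lemma mem_spectralSubspace (hd : HasDiscreteSpectrum A) (hA : IsSelfAdjoint A) {I : Set ℝ} {v : K}
    (h : ∀ c ∉ I, ∀ u ∈ eig A c, inner ℂ u v = 0) : v ∈ spectralSubspace A I := by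
  rw [← proj_eq_self_iff, eq_comm, ← sub_eq_zero]
  refine hd.eq_zero hA fun c u hu => ?_
  rw [inner_sub_right, ← inner_apply_left (proj_isSelfAdjoint _)]
  by_cases hc : c ∈ I
  · rw [proj_eq_self_iff.2 (hd.eig_le_spectralSubspace hA hc hu), sub_self]
  · rw [h c hc u hu, zero_sub, neg_eq_zero]
    have : proj (spectralSubspace A I) u = 0 := spectralProj_apply_of_notMem hc hu
    rw [this, inner_zero_left]

/-- Identities between spectral projections thereby reduce to case distinctions on the eigenvalue
`c`, with no spectral measure needed. -/
lemma ext (hd : HasDiscreteSpectrum A) (hA : IsSelfAdjoint A) {S T : K →L[ℂ] K}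
    (h : ∀ c, ∀ v ∈ eig A c, S v = T v) : S = T := by
  rw [← sub_eq_zero, ← ContinuousLinearMap.adjoint.map_eq_zero_iff]
  ext z
  refine hd.eq_zero hA fun c u hu => ?_
  rw [ContinuousLinearMap.adjoint_inner_right, sub_apply, h c u hu, sub_self, inner_zero_left]

lemma dense_span_eig (hd : HasDiscreteSpectrum A) (hA : IsSelfAdjoint A) :
    Dense ((⨆ c, eig A c : Submodule ℂ K) : Set K) := by
  rw [Submodule.dense_iff_topologicalClosure_eq_top, Submodule.topologicalClosure_eq_top_iff,
    ← Submodule.iInf_orthogonal, eq_bot_iff]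
  intro v hv
  rw [Submodule.mem_iInf] at hv
  exact hd.eq_zero hA fun c u hu => (Submodule.mem_orthogonal _ _).1 (hv c) u hu

/-- The projections `P_{[-n, n]}(A)` converge strongly to the identity. -/
lemma tendsto_spectralProj (hd : HasDiscreteSpectrum A) (hA : IsSelfAdjoint A) (v : K) :
    Filter.Tendsto (fun n : ℕ => (1 - spectralProj A (Icc (-n) n)) v) Filter.atTop (𝓝 0) := by
  have hspan : ∀ u ∈ (⨆ c, eig A c : Submodule ℂ K),
      ∀ᶠ n : ℕ in Filter.atTop, spectralProj A (Icc (-n) n) u = u := by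
    intro u hu
    induction hu using Submodule.iSup_induction' with
    | mem c u hu =>
      filter_upwards [Filter.eventually_ge_atTop ⌈|c|⌉₊] with n hn
      exact hd.spectralProj_apply_of_mem hA (abs_le.1 (Nat.ceil_le.1 hn)) hu
    | zero => simp
    | add u w _ _ hu hw =>
      filter_upwards [hu, hw] with n h1 h2
      rw [map_add, h1, h2]
  rw [Metric.tendsto_atTop]
  intro δ hδ
  obtain ⟨u, hu, huv⟩ := Metric.dense_iff.1 (hd.dense_span_eig hA) v δ hδ
  obtain ⟨N, hN⟩ := Filter.eventually_atTop.1 (hspan _ huv)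
  refine ⟨N, fun n hn => ?_⟩
  have h1 : (1 - spectralProj A (Icc (-n) n)) v = (1 - spectralProj A (Icc (-n) n)) (v - u) := by
    rw [map_sub, eq_comm, sub_eq_self, sub_apply, hN n hn, one_apply_eq_self, sub_self]
  rw [dist_zero_right, h1]
  refine lt_of_le_of_lt (b := ‖v - u‖) ?_ (by rw [← dist_eq_norm, dist_comm]; exact hu)
  have h2 : ‖(1 - spectralProj A (Icc (-n) n) : K →L[ℂ] K)‖ ≤ 1 := by
    have := Submodule.starProjection_norm_le (spectralSubspace A (Icc (-n) n)).toSubmoduleᗮ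
    rwa [Submodule.starProjection_orthogonal'] at this
  exact (ContinuousLinearMap.le_of_opNorm_le _ h2 _).trans (one_mul _).le

end HasDiscreteSpectrum

/-- Factor `F` through its finite dimensional image: there, convergence on a basis is norm
convergence. This is how strong continuity is upgraded to norm continuity. -/
lemma tendsto_mul_isFiniteRank {ι : Type*} {l : Filter ι} {T : ι → K →L[ℂ] K} {T₀ F : K →L[ℂ] K}
    (hF : IsFiniteRank F) (h : ∀ v, Filter.Tendsto (fun i => T i v) l (𝓝 (T₀ v))) :
    Filter.Tendsto (fun i => T i * F) l (𝓝 (T₀ * F)) := by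
  unfold IsFiniteRank at hF
  let V := LinearMap.range F.toLinearMap
  let F' : K →L[ℂ] V := F.codRestrict V fun v => ⟨v, rfl⟩
  let e : (V →L[ℂ] K) ≃L[ℂ] Fin (Module.finrank ℂ V) → K :=
    ((ContinuousLinearEquiv.ofFinrankEq (Module.finrank_fin_fun ℂ).symm).arrowCongr
      (1 : K ≃L[ℂ] K)).trans (ContinuousLinearEquiv.piRing _)
  have h1 : Filter.Tendsto (fun i => T i ∘L V.subtypeL) l (𝓝 (T₀ ∘L V.subtypeL)) := by
    rw [e.toHomeomorph.isInducing.tendsto_nhds_iff]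
    exact tendsto_pi_nhds.2 fun i => h _
  exact (((ContinuousLinearMap.compL ℂ K V K).flip F').continuous.tendsto _).comp h1

lemma HasDiscreteSpectrum.tendsto_spectralProj_mul (hd : HasDiscreteSpectrum A)
    (hA : IsSelfAdjoint A) {F : K →L[ℂ] K} (hF : IsFiniteRank F) :
    Filter.Tendsto (fun n : ℕ => (1 - spectralProj A (Icc (-n) n)) * F) Filter.atTop (𝓝 0) := by
  have := tendsto_mul_isFiniteRank hF (T₀ := 0) (hd.tendsto_spectralProj hA)
  rwa [zero_mul] at this

/-- If `Q` is the spectral projection of a large enough bounded set, then `Q F Q` is close to `F`,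
for self-adjoint `F` of finite rank. -/
lemma HasDiscreteSpectrum.exists_norm_compress_sub_le (hd : HasDiscreteSpectrum A)
    (hA : IsSelfAdjoint A) {F : K →L[ℂ] K} (hF : IsFiniteRank F) (hFs : IsSelfAdjoint F)
    {δ : ℝ} (hδ : 0 < δ) :
    ∃ n : ℕ, ∀ W : Set ℝ, Icc (-(n : ℝ)) n ⊆ W →
      ‖spectralProj A W * F * spectralProj A W - F‖ < δ := by
  have h1 := (hd.tendsto_spectralProj_mul hA hF).norm
  rw [norm_zero] at h1
  obtain ⟨n, hn⟩ := (h1.eventually (gt_mem_nhds (half_pos hδ))).exists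
  refine ⟨n, fun W hW => ?_⟩
  set Q := spectralProj A W
  set P := spectralProj A (Icc (-(n : ℝ)) n)
  have hQs : IsSelfAdjoint Q := proj_isSelfAdjoint _
  have hQ1 : ‖Q‖ ≤ 1 := norm_proj_le _
  -- As `W` contains the interval `[-n, n]`, replacing `F` by `(1 - P) F` does not change `(1 - Q)
  -- F`, so the estimate holds uniformly in `W`.
  have hQP : (1 - Q) * P = 0 := hd.ext hA fun c v hv => by
    by_cases hc : c ∈ Icc (-(n : ℝ)) n
    · rw [mul_apply_eq_comp, hd.spectralProj_apply_of_mem hA hc hv, sub_apply,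
        hd.spectralProj_apply_of_mem hA (hW hc) hv, one_apply_eq_self, sub_self, zero_apply]
    · rw [mul_apply_eq_comp, spectralProj_apply_of_notMem hc hv, map_zero, zero_apply]
  have h2 : (1 - Q) * F = (1 - Q) * ((1 - P) * F) := by
    rw [← mul_assoc, mul_sub, hQP, mul_one, sub_zero]
  have h3 : ‖(1 - Q) * F‖ < δ / 2 := by
    rw [h2]
    have hQ' : ‖1 - Q‖ ≤ 1 := by
      have := Submodule.starProjection_norm_le (spectralSubspace A W).toSubmoduleᗮ
      rwa [Submodule.starProjection_orthogonal'] at this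
    calc _ ≤ ‖1 - Q‖ * ‖(1 - P) * F‖ := norm_mul_le _ _
      _ ≤ 1 * ‖(1 - P) * F‖ := by gcongr
      _ < δ / 2 := by rwa [one_mul]
  have h4 : ‖F * (1 - Q)‖ < δ / 2 := by
    rw [← norm_star, star_mul, star_sub, star_one, hQs.star_eq, hFs.star_eq]
    exact h3
  have h5 : Q * F * Q - F = -((1 - Q) * F * Q + F * (1 - Q)) := by noncomm_ring
  rw [h5, norm_neg]
  calc _ ≤ ‖(1 - Q) * F‖ * ‖Q‖ + ‖F * (1 - Q)‖ := (norm_add_le _ _).trans (by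
        gcongr; exact norm_mul_le _ _)
    _ ≤ ‖(1 - Q) * F‖ * 1 + ‖F * (1 - Q)‖ := by gcongr
    _ < δ := by linarith

lemma spectralSubspace_shift (A : K →ₗ.[ℂ] K) (c : ℝ) (J : Set ℝ) :
    spectralSubspace (shift A c) J = spectralSubspace A ((fun t => t - c) ⁻¹' J) := by
  have hred : ∀ L : ClosedSubmodule ℂ K, Reduces L (shift A c) ↔ Reduces L A := by
    intro L
    constructor
    · intro h v w hvw
      have := h v (w - (c : ℂ) • v) (by rw [mem_graph_shift]; simpa using hvw)
      rw [mem_graph_shift] at this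
      simpa using this
    · intro h v w hvw
      rw [mem_graph_shift] at hvw ⊢
      simpa using h _ _ hvw
  unfold spectralSubspace
  congr 1
  ext L
  simp only [mem_ofPred_eq, hred]
  refine and_congr_right fun _ => ⟨fun h v w hvw hv hv1 => ?_, fun h v w hvw hv hv1 => ?_⟩
  · have := h v (w - (c : ℂ) • v) (by rw [mem_graph_shift]; simpa using hvw) hv hv1
    rw [inner_sub_right, inner_smul_right, inner_self_eq_norm_sq_to_K, hv1] at this
    simpa using this
  · rw [mem_graph_shift] at hvw
    have := h v _ hvw hv hv1
    rw [inner_add_right, inner_smul_right, inner_self_eq_norm_sq_to_K, hv1] at this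
    simpa using this

lemma spectralProj_union (hd : HasDiscreteSpectrum A) (hA : IsSelfAdjoint A) (I J : Set ℝ) :
    spectralProj A (I ∪ J) =
      spectralProj A I + spectralProj A J - spectralProj A I * spectralProj A J := by
  refine hd.ext hA fun c v hv => ?_
  simp only [sub_apply, add_apply, mul_apply_eq_comp]
  by_cases hI : c ∈ I <;> by_cases hJ : c ∈ J
  · rw [hd.spectralProj_apply_of_mem hA (Or.inl hI) hv, hd.spectralProj_apply_of_mem hA hJ hv,
      hd.spectralProj_apply_of_mem hA hI hv, add_sub_cancel_right]
  · rw [hd.spectralProj_apply_of_mem hA (Or.inl hI) hv, spectralProj_apply_of_notMem hJ hv,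
      hd.spectralProj_apply_of_mem hA hI hv, map_zero, add_zero, sub_zero]
  · rw [hd.spectralProj_apply_of_mem hA (Or.inr hJ) hv, hd.spectralProj_apply_of_mem hA hJ hv,
      spectralProj_apply_of_notMem hI hv, zero_add, sub_zero]
  · rw [spectralProj_apply_of_notMem (by simp [hI, hJ] : c ∉ I ∪ J) hv,
      spectralProj_apply_of_notMem hJ hv, spectralProj_apply_of_notMem hI hv, map_zero, add_zero,
      sub_zero]

/-- The end points of the window of an enhanced operator are not eigenvalues. -/
lemma Enhanced.eig_eq_zero {ε : ℝ} (h : Enhanced A ε) {v : K} (hv : v ∈ eig A ε) : v = 0 := by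
  have h1 := h.2.1
  simp only [opSpectrum, mem_ofPred_eq, not_not] at h1
  obtain ⟨R, hR⟩ := h1
  have := (hR 0 v).2 (by rw [zero_add]; exact hv)
  rw [← this, map_zero]

/-- Comparison of the positive spectral projections for two enhanced windows. -/
lemma Enhanced.spectralProj_Ici (hd : HasDiscreteSpectrum A) (hA : IsSelfAdjoint A) {ε ε' : ℝ}
    (h : Enhanced A ε) (h' : Enhanced A ε') :
    spectralProj A (Ici ε') = spectralProj A (Ici ε) * (1 - spectralProj A (Icc (-ε') ε')) +
      spectralProj A (Icc (-ε) ε) * spectralProj A (Ici ε') := by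
  refine hd.ext hA fun c v hv => ?_
  have hε := h.1
  have hε' := h'.1
  by_cases hv0 : v = 0
  · rw [hv0, map_zero, map_zero]
  -- The closed intervals overlap at `ε` and `ε'`, where the identity can fail; enhancedness
  -- excludes these eigenvalues.
  have hc : c ≠ ε := by rintro rfl; exact hv0 (h.eig_eq_zero hv)
  have hc' : c ≠ ε' := by rintro rfl; exact hv0 (h'.eig_eq_zero hv)
  have key : ∀ I : Set ℝ, (c ∈ I ∧ spectralProj A I v = v) ∨ (c ∉ I ∧ spectralProj A I v = 0) :=
    fun I => by
      by_cases hI : c ∈ I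
      · exact .inl ⟨hI, hd.spectralProj_apply_of_mem hA hI hv⟩
      · exact .inr ⟨hI, spectralProj_apply_of_notMem hI hv⟩
  simp only [add_apply, sub_apply, mul_apply_eq_comp, one_apply_eq_self]
  rcases key (Ici ε') with ⟨h1, e1⟩ | ⟨h1, e1⟩ <;> rcases key (Icc (-ε') ε') with ⟨h2, e2⟩ | ⟨h2, e2⟩ <;>
    rcases key (Ici ε) with ⟨h3, e3⟩ | ⟨h3, e3⟩ <;>
    rcases key (Icc (-ε) ε) with ⟨h4, e4⟩ | ⟨h4, e4⟩ <;>
    simp only [e1, e2, e3, e4, map_zero, sub_self, sub_zero, add_zero, zero_add] <;>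
    exfalso <;> simp only [mem_Ici, mem_Icc, not_and, not_le] at h1 h2 h3 h4 <;>
    grind

lemma Enhanced.isFiniteRank_spectralProj {ε : ℝ} (h : Enhanced A ε) :
    IsFiniteRank (spectralProj A (Icc (-ε) ε)) :=
  .proj h.2.2.2

lemma Enhanced.isFiniteRank_sub (hd : HasDiscreteSpectrum A) (hA : IsSelfAdjoint A) {ε ε' : ℝ}
    (h : Enhanced A ε) (h' : Enhanced A ε') :
    IsFiniteRank (spectralProj A (Ici ε') - spectralProj A (Ici ε)) := by
  rw [h.spectralProj_Ici hd hA h']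
  convert (h.isFiniteRank_spectralProj.mul_right (spectralProj A (Ici ε'))).sub
    (h'.isFiniteRank_spectralProj.mul_left (spectralProj A (Ici ε))) using 1
  noncomm_ring

end SpectralSubspaces

/-! ### Turning almost projections into projections; commensurability as finite rank. -/

section Cutoff

variable {K : Type*} [NormedAddCommGroup K] [InnerProductSpace ℂ K] [CompleteSpace K]

/-- A continuous function equal to `0` on `(-∞, 1/4]` and to `1` on `[3/4, ∞)`. -/
def cutoff (t : ℝ) : ℝ := max 0 (min 1 (2 * t - 1 / 2))

lemma continuous_cutoff : Continuous cutoff := by unfold cutoff; fun_prop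

lemma cutoff_of_le {t : ℝ} (h : t ≤ 1 / 4) : cutoff t = 0 :=
  max_eq_left ((min_le_right _ _).trans (by linarith))

lemma cutoff_of_ge {t : ℝ} (h : 3 / 4 ≤ t) : cutoff t = 1 := by
  rw [cutoff, min_eq_left (by linarith), max_eq_right zero_le_one]

/-- As `cutoff` vanishes near `0`, it is a continuous multiple of the identity function, so `cfc
cutoff T` factors as an operator after `T`. -/
lemma cutoff_apply_of_apply_eq_zero {T : K →L[ℂ] K} (hT : IsSelfAdjoint T) {v : K}
    (h : T v = 0) : cfc cutoff T v = 0 := by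
  have hc := continuous_cutoff
  have hm : ∀ t : ℝ, max t (1 / 4) ≠ 0 := fun t => by
    have := le_max_right t (1 / 4); positivity
  have hg : Continuous fun t : ℝ => cutoff t / max t (1 / 4) := hc.div (by fun_prop) hm
  have : cutoff = fun t => (cutoff t / max t (1 / 4)) * t := by
    ext t
    rcases le_total t (1 / 4) with ht | ht
    · simp [cutoff_of_le ht]
    · rw [max_eq_left ht, div_mul_cancel₀ _ (by linarith)]
  rw [this, cfc_mul _ _ T hg.continuousOn (by fun_prop), cfc_id' ℝ T, mul_apply_eq_comp, h,
    map_zero]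

lemma cutoff_one_sub (t : ℝ) : cutoff (1 - t) = 1 - cutoff t := by
  rcases le_total t (1 / 4) with ht | ht
  · rw [cutoff_of_le ht, cutoff_of_ge (by linarith), sub_zero]
  rcases le_total t (3 / 4) with ht' | ht'
  · unfold cutoff
    rw [min_eq_right (by linarith), min_eq_right (by linarith), max_eq_right (by linarith),
      max_eq_right (by linarith)]
    ring
  · rw [cutoff_of_ge ht', cutoff_of_le (by linarith), sub_self]

lemma cfc_cutoff_one_sub {T : K →L[ℂ] K} (hT : IsSelfAdjoint T) :
    cfc cutoff (1 - T) = 1 - cfc cutoff T := by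
  have hc := continuous_cutoff
  have h1 : (1 : K →L[ℂ] K) - T = cfc (fun t : ℝ => 1 - t) T := by
    rw [cfc_sub _ _ T (by fun_prop) (by fun_prop), cfc_const_one ℝ T, cfc_id' ℝ T]
  rw [h1, ← cfc_comp' cutoff (fun t : ℝ => 1 - t) T (by fun_prop) (by fun_prop)]
  simp_rw [cutoff_one_sub]
  rw [cfc_sub _ _ T (by fun_prop) (by fun_prop), cfc_const_one ℝ T]

lemma cutoff_apply_of_apply_eq_self {T : K →L[ℂ] K} (hT : IsSelfAdjoint T) {v : K}
    (h : T v = v) : cfc cutoff T v = v := by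
  have h1 := cutoff_apply_of_apply_eq_zero (T := 1 - T) (v := v) (.sub (.one _) hT) (by
    rw [sub_apply, h, one_apply_eq_self, sub_self])
  rw [cfc_cutoff_one_sub hT, sub_apply, one_apply_eq_self] at h1
  exact (sub_eq_zero.1 h1).symm

lemma abs_le_norm_of_mem_spectrum {T : K →L[ℂ] K} {t : ℝ} (h : t ∈ spectrum ℝ T) : |t| ≤ ‖T‖ := by
  rcases subsingleton_or_nontrivial K with hK | hK
  · rw [spectrum.of_subsingleton] at h
    exact h.elim
  · exact spectrum.norm_le_norm_of_mem h

/-- Closeness to an idempotent makes `T² - T` small, which keeps the spectrum of `T` out of `[1/4,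
3/4]`; elsewhere `cutoff` takes only the values `0` and `1`. -/
lemma cfc_cutoff_mul_self {P T : K →L[ℂ] K} (hP : P * P = P) (hP1 : ‖P‖ ≤ 1)
    (hT : IsSelfAdjoint T) (h : ‖T - P‖ ≤ 1 / 20) : cfc cutoff T * cfc cutoff T = cfc cutoff T := by
  have hc := continuous_cutoff
  have h1 : T * T - T = P * (T - P) + (T - P) * P + (T - P) * (T - P) - (T - P) := by
    have : T * T - T = P * (T - P) + (T - P) * P + (T - P) * (T - P) - (T - P) + (P * P - P) := by
      noncomm_ring
    rw [this, hP, sub_self, add_zero]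
  -- `3/16` is the minimum of `t - t²` on `[1/4, 3/4]`, while the terms below add up to `3/20 +
  -- 1/400`.
  have h2 : ‖T * T - T‖ < 3 / 16 := by
    set D := T - P
    have a1 : ‖P * D‖ ≤ 1 * (1 / 20) := (norm_mul_le _ _).trans (by gcongr)
    have a2 : ‖D * P‖ ≤ 1 / 20 * 1 := (norm_mul_le _ _).trans (by gcongr)
    have a3 : ‖D * D‖ ≤ 1 / 20 * (1 / 20) := (norm_mul_le _ _).trans (by gcongr)
    have a4 := norm_sub_le (P * D + D * P + D * D) D
    have a5 := norm_add₃_le (a := P * D) (b := D * P) (c := D * D)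
    rw [h1]
    linarith
  rw [← cfc_mul _ _ T (by fun_prop) (by fun_prop)]
  refine cfc_congr fun t ht => ?_
  have h3 : t * t - t ∈ spectrum ℝ (T * T - T) := by
    have : T * T - T = cfc (fun t : ℝ => t * t - t) T := by
      rw [cfc_sub _ _ T (by fun_prop) (by fun_prop), cfc_mul _ _ T (by fun_prop) (by fun_prop),
        cfc_id' ℝ T]
    rw [this, cfc_map_spectrum _ T]
    exact ⟨t, ht, rfl⟩
  have h4 := abs_lt.1 ((abs_le_norm_of_mem_spectrum h3).trans_lt h2)
  rcases le_total t (1 / 4) with h5 | h5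
  · simp [cutoff_of_le h5]
  rcases le_total (3 / 4) t with h6 | h6
  · simp [cutoff_of_ge h6]
  · nlinarith

lemma cfc_cutoff_eq_self {P : K →L[ℂ] K} (hP : P * P = P) (hPs : IsSelfAdjoint P) :
    cfc cutoff P = P := by
  ext v
  have h1 := cutoff_apply_of_apply_eq_self hPs (v := P v) (congrArg (fun T : K →L[ℂ] K => T v) hP)
  have h2 := cutoff_apply_of_apply_eq_zero hPs (v := v - P v) (by
    rw [map_sub]
    exact sub_eq_zero.2 (congrArg (fun T : K →L[ℂ] K => T v) hP).symm)
  rw [map_sub, h1] at h2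
  exact sub_eq_zero.1 h2

/-- If `T` and `P` agree on both `v` and `P v`, then `T` fixes `P v` and kills `v - P v`, hence `cfc
cutoff T v = P v`. Such `v` form a subspace of finite codimension, the kernel of `g` below. -/
lemma isFiniteRank_cfc_cutoff_sub {P T : K →L[ℂ] K} (hP : P * P = P)
    (hT : IsSelfAdjoint T) (h : IsFiniteRank (T - P)) : IsFiniteRank (cfc cutoff T - P) := by
  have hk : ∀ v, P (P v) = P v := fun v => congrArg (fun T : K →L[ℂ] K => T v) hP
  have main : ∀ v, (T - P) v = 0 → (T - P) (P v) = 0 → (cfc cutoff T - P) v = 0 := by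
    intro v h1 h2
    rw [sub_apply, sub_eq_zero] at h1 h2
    have h3 := cutoff_apply_of_apply_eq_self hT (h2.trans (hk v))
    have h4 := cutoff_apply_of_apply_eq_zero hT (v := v - P v) (by
      rw [map_sub, h1, h2, hk, sub_self])
    rw [map_sub, h3] at h4
    rw [sub_apply, h4]
  unfold IsFiniteRank at *
  let D : K →L[ℂ] K := T - P
  let g : K →ₗ[ℂ] LinearMap.range D.toLinearMap × LinearMap.range D.toLinearMap :=
    (D.toLinearMap.rangeRestrict).prod (D.toLinearMap.rangeRestrict ∘ₗ P.toLinearMap)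
  have : FiniteDimensional ℂ (LinearMap.range D.toLinearMap) := h
  have e := g.quotKerEquivRange
  have : FiniteDimensional ℂ (K ⧸ LinearMap.ker g) := e.symm.finiteDimensional
  let G := (LinearMap.ker g).liftQ (cfc cutoff T - P).toLinearMap (fun v hv => by
    have hv' : g v = 0 := hv
    have h1 := congrArg (fun p => (p.1 : K)) hv'
    have h2 := congrArg (fun p => (p.2 : K)) hv'
    exact main v h1 h2)
  have : LinearMap.range (cfc cutoff T - P).toLinearMap = LinearMap.range G :=
    (Submodule.range_liftQ _ _ _).symm
  rw [this]
  infer_instance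

/-- The norm bound confines all the spectra to one compact interval, as continuity of the functional
calculus in the operator requires. -/
lemma tendsto_cfc_cutoff {ι : Type*} {l : Filter ι} {T : ι → K →L[ℂ] K} {T₀ : K →L[ℂ] K}
    (h : Filter.Tendsto T l (𝓝 T₀)) (hT : ∀ i, IsSelfAdjoint (T i)) (hT₀ : IsSelfAdjoint T₀)
    (hn : ∀ i, ‖T i‖ ≤ 2) (hn₀ : ‖T₀‖ ≤ 2) :
    Filter.Tendsto (fun i => cfc cutoff (T i)) l (𝓝 (cfc cutoff T₀)) := by
  have hc := continuous_cutoff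
  have hs : ∀ S : K →L[ℂ] K, ‖S‖ ≤ 2 → spectrum ℝ S ⊆ Icc (-2) 2 := fun S hS t ht =>
    abs_le.1 ((abs_le_norm_of_mem_spectrum ht).trans hS)
  exact h.cfc isCompact_Icc cutoff (.of_forall fun i => hs _ (hn i))
    (.of_forall hT) (hs _ hn₀) hT₀

/-- The closed subspace of the fixed vectors of an operator. -/
def fixedSpace (p : K →L[ℂ] K) : ClosedSubmodule ℂ K :=
  ⟨LinearMap.ker (1 - p).toLinearMap, ContinuousLinearMap.isClosed_ker (1 - p)⟩

lemma mem_fixedSpace {p : K →L[ℂ] K} {v : K} : v ∈ fixedSpace p ↔ p v = v :=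
  (sub_eq_zero (a := v) (b := p v)).trans eq_comm

lemma proj_fixedSpace {p : K →L[ℂ] K} (hp : p * p = p) (hps : IsSelfAdjoint p) :
    proj (fixedSpace p) = p := by
  ext v
  refine Submodule.eq_starProjection_of_mem_orthogonal
    (mem_fixedSpace.2 (congrArg (fun T : K →L[ℂ] K => T v) hp)) ?_
  rw [Submodule.mem_orthogonal]
  intro u hu
  rw [inner_sub_right, ← inner_apply_left hps, mem_fixedSpace.1 hu, sub_self]

lemma fixedSpace_proj (L : ClosedSubmodule ℂ K) : fixedSpace (proj L) = L := by
  ext v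
  exact mem_fixedSpace.trans proj_eq_self_iff

lemma finiteDimensional_quotient_of_isFiniteRank_sub {L M : ClosedSubmodule ℂ K}
    (h : IsFiniteRank (proj L - proj M)) : FiniteDimensional ℂ
      (L.toSubmodule ⧸ (L.toSubmodule ⊓ M.toSubmodule).submoduleOf L.toSubmodule) := by
  unfold IsFiniteRank at h
  let D := ((proj L - proj M).toLinearMap).rangeRestrict ∘ₗ L.toSubmodule.subtype
  have e := D.quotKerEquivRange
  have : FiniteDimensional ℂ (L.toSubmodule ⧸ LinearMap.ker D) := e.symm.finiteDimensional
  have : (L.toSubmodule ⊓ M.toSubmodule).submoduleOf L.toSubmodule = LinearMap.ker D := by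
    ext ⟨v, hv⟩
    have h1 : (⟨v, hv⟩ : L.toSubmodule) ∈ LinearMap.ker D ↔ proj L v - proj M v = 0 :=
      Subtype.ext_iff
    rw [h1, proj_eq_self_iff.2 hv, sub_eq_zero, eq_comm, proj_eq_self_iff]
    exact ⟨fun h => h.2, fun h => ⟨hv, h⟩⟩
  rw [this]
  infer_instance

lemma commensurable_of_isFiniteRank_sub {L M : ClosedSubmodule ℂ K}
    (h : IsFiniteRank (proj L - proj M)) : Commensurable L M := by
  refine ⟨finiteDimensional_quotient_of_isFiniteRank_sub h, ?_⟩
  rw [inf_comm]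
  refine finiteDimensional_quotient_of_isFiniteRank_sub ?_
  simpa using h.neg

/-- The difference factors through `proj L` and vanishes on `L ⊓ M`, so its image is that of the
finite dimensional quotient. -/
lemma isFiniteRank_proj_sub_inf {L M : ClosedSubmodule ℂ K} (h : FiniteDimensional ℂ
      (L.toSubmodule ⧸ (L.toSubmodule ⊓ M.toSubmodule).submoduleOf L.toSubmodule)) :
    IsFiniteRank (proj L - proj (L ⊓ M)) := by
  let f : L.toSubmodule →ₗ[ℂ] K := (proj L - proj (L ⊓ M)).toLinearMap ∘ₗ L.toSubmodule.subtype
  let g := ((L.toSubmodule ⊓ M.toSubmodule).submoduleOf L.toSubmodule).liftQ f (by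
    rintro ⟨v, hvL⟩ hv
    have hv' : v ∈ L ⊓ M := hv
    show proj L v - proj (L ⊓ M) v = 0
    rw [proj_eq_self_iff.2 hv', proj_eq_self_iff.2 hvL, sub_self])
  refine .of_le (V := LinearMap.range g) fun v => ?_
  rw [Submodule.range_liftQ]
  refine ⟨⟨proj L v, proj_mem L v⟩, ?_⟩
  show proj L (proj L v) - proj (L ⊓ M) (proj L v) = proj L v - proj (L ⊓ M) v
  have h1 : proj (L ⊓ M) (v - proj L v) = 0 := by
    refine proj_eq_zero_iff.2 fun u hu => ?_
    rw [inner_sub_right, ← inner_apply_left (proj_isSelfAdjoint L), proj_eq_self_iff.2 hu.1,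
      sub_self]
  rw [map_sub, sub_eq_zero] at h1
  rw [proj_eq_self_iff.2 (proj_mem L v), h1]

lemma Commensurable.isFiniteRank_sub {L M : ClosedSubmodule ℂ K} (h : Commensurable L M) :
    IsFiniteRank (proj L - proj M) := by
  have h1 := isFiniteRank_proj_sub_inf h.1
  have h2 := isFiniteRank_proj_sub_inf (L := M) (M := L) (by rw [inf_comm]; exact h.2)
  rw [inf_comm] at h2
  simpa using h1.sub h2

end Cutoff

/-! ### Changing local trivializations. -/

section Transfer

variable {X : Type*} [TopologicalSpace X]
variable {H : Type*} [NormedAddCommGroup H] [InnerProductSpace ℂ H] [CompleteSpace H]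
variable {E : X → Type*} [∀ x, NormedAddCommGroup (E x)] [∀ x, InnerProductSpace ℂ (E x)]
variable [TopologicalSpace (TotalSpace H E)] [∀ x, CompleteSpace (E x)]

namespace HilbertTriv

open Classical in
/-- The extension of `conj` by zero outside the domain of the trivialization. -/
def ext (t : HilbertTriv H E) (x : X) (T : E x →L[ℂ] E x) : H →L[ℂ] H :=
  if h : x ∈ t.baseSet then t.conj ⟨x, h⟩ T else 0

variable (t t' : HilbertTriv H E)

variable {t} in
lemma ext_of_mem {x : X} (h : x ∈ t.baseSet) (T : E x →L[ℂ] E x) :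
    t.ext x T = (t.iso ⟨x, h⟩).conjStarAlgEquiv T := dif_pos h

variable {t} in
lemma ext_of_notMem {x : X} (h : x ∉ t.baseSet) (T : E x →L[ℂ] E x) : t.ext x T = 0 := dif_neg h

lemma ext_mul (x : X) (S T : E x →L[ℂ] E x) : t.ext x (S * T) = t.ext x S * t.ext x T := by
  by_cases h : x ∈ t.baseSet
  · simp only [ext_of_mem h, map_mul]
  · simp only [ext_of_notMem h, mul_zero]

lemma ext_add (x : X) (S T : E x →L[ℂ] E x) : t.ext x (S + T) = t.ext x S + t.ext x T := by
  by_cases h : x ∈ t.baseSet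
  · simp only [ext_of_mem h, map_add]
  · simp only [ext_of_notMem h, add_zero]

lemma ext_zero (x : X) : t.ext x 0 = 0 := by
  by_cases h : x ∈ t.baseSet
  · simp only [ext_of_mem h, map_zero]
  · simp only [ext_of_notMem h]

/-- `ext` as an additive homomorphism. -/
def extHom (x : X) : (E x →L[ℂ] E x) →+ (H →L[ℂ] H) where
  toFun := t.ext x
  map_zero' := t.ext_zero x
  map_add' := t.ext_add x

lemma ext_sub (x : X) (S T : E x →L[ℂ] E x) : t.ext x (S - T) = t.ext x S - t.ext x T :=
  (t.extHom x).map_sub S T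

lemma ext_smul (x : X) (a : ℝ) (T : E x →L[ℂ] E x) : t.ext x (a • T) = a • t.ext x T := by
  by_cases h : x ∈ t.baseSet
  · simp only [ext_of_mem h]
    exact map_smul (t.iso ⟨x, h⟩).conjStarAlgEquiv (a : ℂ) T
  · simp only [ext_of_notMem h, smul_zero]

lemma ext_star (x : X) (T : E x →L[ℂ] E x) : t.ext x (star T) = star (t.ext x T) := by
  by_cases h : x ∈ t.baseSet
  · rw [ext_of_mem h, ext_of_mem h]
    exact (t.iso ⟨x, h⟩).conjStarAlgEquiv.map_star' T
  · simp only [ext_of_notMem h, star_zero]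

lemma isSelfAdjoint_ext {x : X} {T : E x →L[ℂ] E x} (hT : IsSelfAdjoint T) :
    IsSelfAdjoint (t.ext x T) := by
  rw [isSelfAdjoint_iff, ← ext_star, hT.star_eq]

lemma norm_ext_le (x : X) (T : E x →L[ℂ] E x) : ‖t.ext x T‖ ≤ ‖T‖ := by
  by_cases h : x ∈ t.baseSet
  · rw [ext_of_mem h]
    refine ContinuousLinearMap.opNorm_le_bound _ (norm_nonneg _) fun v => ?_
    rw [LinearIsometryEquiv.conjStarAlgEquiv_apply_apply, LinearIsometryEquiv.norm_map]
    exact (T.le_opNorm _).trans (by rw [LinearIsometryEquiv.norm_map])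
  · simp [ext_of_notMem h]

variable {t} in
lemma norm_ext {x : X} (h : x ∈ t.baseSet) (T : E x →L[ℂ] E x) : ‖t.ext x T‖ = ‖T‖ := by
  refine le_antisymm (t.norm_ext_le x T) ?_
  refine ContinuousLinearMap.opNorm_le_bound _ (norm_nonneg _) fun v => ?_
  have h1 := (t.ext x T).le_opNorm (t.iso ⟨x, h⟩ v)
  rwa [LinearIsometryEquiv.norm_map, ext_of_mem h,
    LinearIsometryEquiv.conjStarAlgEquiv_apply_apply, LinearIsometryEquiv.norm_map,
    LinearIsometryEquiv.symm_apply_apply, ← ext_of_mem h] at h1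

lemma continuous_conjStarAlgEquiv {K L : Type*} [NormedAddCommGroup K] [InnerProductSpace ℂ K]
    [CompleteSpace K] [NormedAddCommGroup L] [InnerProductSpace ℂ L] [CompleteSpace L]
    (e : K ≃ₗᵢ[ℂ] L) : Continuous e.conjStarAlgEquiv := by
  have : (e.conjStarAlgEquiv : (K →L[ℂ] K) → (L →L[ℂ] L)) =
    fun T => e.toContinuousLinearEquiv.toContinuousLinearMap ∘L T ∘L
      e.symm.toContinuousLinearEquiv.toContinuousLinearMap := rfl
  rw [this]
  fun_prop

lemma ext_cfc {x : X} {T : E x →L[ℂ] E x} (hT : IsSelfAdjoint T) {f : ℝ → ℝ} (hf : Continuous f)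
    (h : x ∈ t.baseSet) : t.ext x (cfc f T) = cfc f (t.ext x T) := by
  have h2 := t.isSelfAdjoint_ext hT
  rw [ext_of_mem h] at h2
  rw [ext_of_mem h, ext_of_mem h]
  exact StarAlgHomClass.map_cfc (S := ℂ) (t.iso ⟨x, h⟩).conjStarAlgEquiv f T hf.continuousOn
    (continuous_conjStarAlgEquiv _) hT h2

lemma isFiniteRank_ext {x : X} {T : E x →L[ℂ] E x} (hT : IsFiniteRank T) :
    IsFiniteRank (t.ext x T) := by
  by_cases h : x ∈ t.baseSet
  · rw [ext_of_mem h]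
    unfold IsFiniteRank at hT
    exact .of_le (V := (LinearMap.range T.toLinearMap).map
      (t.iso ⟨x, h⟩).toLinearEquiv.toLinearMap) fun v => ⟨_, ⟨_, rfl⟩, rfl⟩
  · rw [ext_of_notMem h]; exact .zero

open Classical in
/-- The transition map from `t'` to `t`, extended by zero. -/
def transition (x : X) : H →L[ℂ] H :=
  if h : x ∈ t.baseSet ∧ x ∈ t'.baseSet then
    ((t'.iso ⟨x, h.2⟩).symm.trans (t.iso ⟨x, h.1⟩)).toContinuousLinearEquiv.toContinuousLinearMap
  else 0

variable {t t'} in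
lemma transition_apply {x : X} (h : x ∈ t.baseSet) (h' : x ∈ t'.baseSet) (v : H) :
    t.transition t' x v = t.iso ⟨x, h⟩ ((t'.iso ⟨x, h'⟩).symm v) := by
  rw [transition, dif_pos ⟨h, h'⟩]; rfl

lemma norm_transition_le (x : X) : ‖t.transition t' x‖ ≤ 1 := by
  by_cases h : x ∈ t.baseSet ∧ x ∈ t'.baseSet
  · refine ContinuousLinearMap.opNorm_le_bound _ zero_le_one fun v => ?_
    rw [transition_apply h.1 h.2, LinearIsometryEquiv.norm_map, LinearIsometryEquiv.norm_map,
      one_mul]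
  · rw [transition, dif_neg h, norm_zero]; exact zero_le_one

variable {t t'} in
lemma continuousAt_transition_apply {x : X} (h : x ∈ t.baseSet) (h' : x ∈ t'.baseSet) (v : H) :
    ContinuousAt (fun y => t.transition t' y v) x := by
  have hinv : ∀ y (hy : y ∈ t'.baseSet),
      t'.invFun (y, v) = ⟨y, (t'.iso ⟨y, hy⟩).symm v⟩ := by
    intro y hy
    have h1 := t'.iso_apply ⟨y, hy⟩ ((t'.iso ⟨y, hy⟩).symm v)
    rw [LinearIsometryEquiv.apply_symm_apply] at h1
    rw [← h1]
    refine t'.left_inv ?_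
    rw [t'.source_eq]
    exact hy
  have h1 : ContinuousAt (fun y : X => t'.invFun (y, v)) x := by
    have hm : (x, v) ∈ t'.target := by rw [t'.target_eq]; exact ⟨h', mem_univ _⟩
    have h2 : ContinuousAt t'.invFun (x, v) :=
      t'.continuousOn_invFun.continuousAt (t'.open_target.mem_nhds hm)
    exact ContinuousAt.comp (f := fun y : X => (y, v)) h2 (by fun_prop)
  have h3 : ContinuousAt (fun y : X => t.toFun (t'.invFun (y, v))) x := by
    have hm : t'.invFun (x, v) ∈ t.source := by rw [t.source_eq, hinv x h']; exact h
    have h2 : ContinuousAt t.toFun (t'.invFun (x, v)) :=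
      t.continuousOn_toFun.continuousAt (t.open_source.mem_nhds hm)
    exact ContinuousAt.comp (f := fun y : X => t'.invFun (y, v)) h2 h1
  refine h3.snd.congr ?_
  filter_upwards [t.open_baseSet.mem_nhds h, t'.open_baseSet.mem_nhds h'] with y hy hy'
  rw [hinv y hy', transition_apply hy hy']
  exact congrArg Prod.snd (t.iso_apply ⟨y, hy⟩ _)

variable {t t'} in
lemma ext_eq_transition {x : X} (h : x ∈ t.baseSet) (h' : x ∈ t'.baseSet) (T : E x →L[ℂ] E x) :
    t.ext x T = t.transition t' x * t'.ext x T * star (t.transition t' x) := by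
  have h1 : star (t.transition t' x) = t'.transition t x := by
    rw [transition, transition, dif_pos ⟨h, h'⟩, dif_pos ⟨h', h⟩]
    exact LinearIsometryEquiv.adjoint_eq_symm
      ((t'.iso ⟨x, h'⟩).symm.trans (t.iso ⟨x, h⟩))
  ext v
  rw [h1, ext_of_mem h, ext_of_mem h']
  simp only [mul_apply_eq_comp, LinearIsometryEquiv.conjStarAlgEquiv_apply_apply,
    transition_apply h h', transition_apply h' h, LinearIsometryEquiv.symm_apply_apply]

variable {t t'} in
/-- Convergence of operators to a self-adjoint operator of finite rank does not depend on the
local trivialization. -/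
lemma tendsto_ext_of_isFiniteRank {Z : Type*} {l : Filter Z} {b : Z → X} {x : X}
    (h : x ∈ t.baseSet) (h' : x ∈ t'.baseSet) (hb : Filter.Tendsto b l (𝓝 x))
    {T : ∀ z, E (b z) →L[ℂ] E (b z)} {T₀ : E x →L[ℂ] E x} (hT₀ : IsFiniteRank T₀)
    (hs : IsSelfAdjoint T₀)
    (hT : Filter.Tendsto (fun z => t'.ext (b z) (T z)) l (𝓝 (t'.ext x T₀))) :
    Filter.Tendsto (fun z => t.ext (b z) (T z)) l (𝓝 (t.ext x T₀)) := by
  set p := t'.ext x T₀ with hp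
  have hps : IsSelfAdjoint p := t'.isSelfAdjoint_ext hs
  have hpf : IsFiniteRank p := t'.isFiniteRank_ext hT₀
  have hpf' := hpf
  unfold IsFiniteRank at hpf'
  let N : ClosedSubmodule ℂ H :=
    ⟨LinearMap.range p.toLinearMap, Submodule.closed_of_finiteDimensional _⟩
  have hN : IsFiniteRank (proj N) := .proj hpf'
  have hNp : proj N * p = p := by
    ext v
    exact proj_eq_self_iff.2 ⟨v, rfl⟩
  have hpN : p * star (proj N) = p := by
    rw [← hps.star_eq, ← star_mul, hNp]
  let g := fun z => t.transition t' (b z)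
  let g₀ := t.transition t' x
  -- The transition maps `g z` converge only strongly, but `p` is unchanged by compression to its
  -- image `N`, on which they converge in norm. The remaining error is controlled by `‖g z‖ ≤ 1`.
  have h1 : Filter.Tendsto (fun z => g z * proj N) l (𝓝 (g₀ * proj N)) :=
    tendsto_mul_isFiniteRank hN fun v =>
      (continuousAt_transition_apply h h' v).tendsto.comp hb
  have key : ∀ k : H →L[ℂ] H, k * p * star k = (k * proj N) * p * star (k * proj N) := by
    intro k
    calc k * p * star k = k * (proj N * p * star (proj N)) * star k := by rw [hNp, hpN]
      _ = _ := by rw [star_mul]; noncomm_ring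
  have h2 : Filter.Tendsto (fun z => g z * p * star (g z)) l (𝓝 (t.ext x T₀)) := by
    rw [ext_eq_transition h h', key]
    rw [show (fun z => g z * p * star (g z)) = _ from funext fun z => key (g z)]
    exact (h1.mul_const p).mul h1.star
  have h3 : Filter.Tendsto (fun z => g z * (t'.ext (b z) (T z) - p) * star (g z)) l (𝓝 0) := by
    rw [tendsto_iff_norm_sub_tendsto_zero] at hT
    refine squeeze_zero_norm (fun z => ?_) hT
    have hg : ‖g z‖ ≤ 1 := t.norm_transition_le t' (b z)
    calc _ ≤ ‖g z‖ * ‖t'.ext (b z) (T z) - p‖ * ‖g z‖ := by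
          refine (norm_mul_le _ _).trans ?_
          rw [norm_star]
          gcongr
          exact norm_mul_le _ _
      _ ≤ 1 * ‖t'.ext (b z) (T z) - p‖ * 1 := by gcongr
      _ = _ := by rw [one_mul, mul_one]
  have h4 := h3.add h2
  rw [zero_add] at h4
  refine h4.congr' ?_
  filter_upwards [hb (t.open_baseSet.mem_nhds h), hb (t'.open_baseSet.mem_nhds h')] with z hz hz'
  rw [ext_eq_transition hz hz']
  noncomm_ring

lemma continuousAt_ext_iff {T : ∀ x, E x →L[ℂ] E x} {U : Set X} (hU : IsOpen U) {x : X}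
    (hx : x ∈ U) (h : x ∈ t.baseSet) :
    ContinuousAt (fun y => t.ext y (T y)) x ↔
      ContinuousAt (fun y : (U ∩ t.baseSet : Set X) => t.conj ⟨y, y.2.2⟩ (T y)) ⟨x, hx, h⟩ := by
  rw [← (hU.inter t.open_baseSet).isOpenEmbedding_subtypeVal.continuousAt_iff
    (x := (⟨x, hx, h⟩ : (U ∩ t.baseSet : Set X)))]
  have : (fun y => t.ext y (T y)) ∘ Subtype.val =
      fun y : (U ∩ t.baseSet : Set X) => t.conj ⟨y, y.2.2⟩ (T y) := by
    ext1 y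
    exact ext_of_mem y.2.2 _
  rw [this]

end HilbertTriv

lemma ContinuousFamilyOn.continuousAt {T : ∀ x, E x →L[ℂ] E x} {U : Set X}
    (hT : ContinuousFamilyOn H T U) (hU : IsOpen U) {x : X} (hx : x ∈ U)
    (hf : IsFiniteRank (T x)) (hs : IsSelfAdjoint (T x)) {t : HilbertTriv H E}
    (h : x ∈ t.baseSet) : ContinuousAt (fun y => t.ext y (T y)) x := by
  obtain ⟨t', h', hc⟩ := hT x hx
  refine HilbertTriv.tendsto_ext_of_isFiniteRank h h' Filter.tendsto_id hf hs ?_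
  exact (t'.continuousAt_ext_iff hU hx h').2 hc.continuousAt

end Transfer

lemma spectralProj_inter {K : Type*} [NormedAddCommGroup K] [InnerProductSpace ℂ K]
    [CompleteSpace K] {A : K →ₗ.[ℂ] K} (hd : HasDiscreteSpectrum A) (hA : IsSelfAdjoint A)
    (I J : Set ℝ) : spectralProj A I * spectralProj A J = spectralProj A (I ∩ J) := by
  refine hd.ext hA fun c v hv => ?_
  rw [mul_apply_eq_comp]
  by_cases hJ : c ∈ J
  · rw [hd.spectralProj_apply_of_mem hA hJ hv]
    by_cases hI : c ∈ I
    · rw [hd.spectralProj_apply_of_mem hA hI hv,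
        hd.spectralProj_apply_of_mem hA (show c ∈ I ∩ J from ⟨hI, hJ⟩) hv]
    · rw [spectralProj_apply_of_notMem hI hv, spectralProj_apply_of_notMem (fun h : c ∈ I ∩ J => hI h.1) hv]
  · rw [spectralProj_apply_of_notMem hJ hv, spectralProj_apply_of_notMem (fun h : c ∈ I ∩ J => hJ h.2) hv,
      map_zero]

/-! ### Continuity of spectral projections and the topology of the Grassmannian bundle. -/

section Families

variable {X : Type*} [TopologicalSpace X]
variable {H : Type*} [NormedAddCommGroup H] [InnerProductSpace ℂ H] [CompleteSpace H]
variable {E : X → Type*} [∀ x, NormedAddCommGroup (E x)] [∀ x, InnerProductSpace ℂ (E x)]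
variable [TopologicalSpace (TotalSpace H E)] [∀ x, CompleteSpace (E x)]
variable {A : ∀ x, E x →ₗ.[ℂ] E x}

lemma IsDiscreteSpectrumFamily.hasDiscreteSpectrum (h : IsDiscreteSpectrumFamily H A) (x : X) :
    HasDiscreteSpectrum (A x) := fun c => by
  obtain ⟨U, ε, -, hx, hU⟩ := (h c).2 x
  exact ⟨ε, hU.1 x hx⟩

lemma Adapted.continuousAt {U : Set X} {ε : ℝ} (h : Adapted H A U ε) (hU : IsOpen U) {x : X}
    (hx : x ∈ U) {t : HilbertTriv H E} (ht : x ∈ t.baseSet) :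
    ContinuousAt (fun y => t.ext y (spectralProj (A y) (Icc (-ε) ε))) x :=
  h.2.1.continuousAt hU hx (h.1 x hx).isFiniteRank_spectralProj (proj_isSelfAdjoint _) ht

/-- A bounded set of spectral parameters, containing a given compact one, whose spectral
projections are continuous near a given point. -/
lemma IsDiscreteSpectrumFamily.exists_window (h : IsDiscreteSpectrumFamily H A)
    (hA : ∀ x, IsSelfAdjoint (A x)) (x : X) {s : Set ℝ} (hs : IsCompact s) :
    ∃ (W : Set ℝ) (M : ℝ) (U : Set X), s ⊆ W ∧ W ⊆ Icc (-M) M ∧ IsOpen U ∧ x ∈ U ∧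
      ∀ y ∈ U, ∀ t : HilbertTriv H E, y ∈ t.baseSet →
        ContinuousAt (fun z => t.ext z (spectralProj (A z) W)) y := by
  have hd := h.hasDiscreteSpectrum
  -- Compactness induction: near each `c ∈ s` the Fredholm condition on `A - c` supplies an interval
  -- around `c`, and continuity passes to unions by `spectralProj_union`.
  refine hs.induction_on (p := fun s => ∃ (W : Set ℝ) (M : ℝ) (U : Set X), s ⊆ W ∧
    W ⊆ Icc (-M) M ∧ IsOpen U ∧ x ∈ U ∧ ∀ y ∈ U, ∀ t : HilbertTriv H E, y ∈ t.baseSet →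
      ContinuousAt (fun z => t.ext z (spectralProj (A z) W)) y) ?_ ?_ ?_ ?_
  · refine ⟨∅, 0, univ, Subset.rfl, empty_subset _, isOpen_univ, mem_univ _, fun y _ t _ => ?_⟩
    have : (fun z => t.ext z (spectralProj (A z) ∅)) = fun _ => 0 := by
      ext1 z
      rw [(hd z).ext (hA z) (S := spectralProj (A z) ∅) (T := 0) fun c v hv =>
        spectralProj_apply_of_notMem (notMem_empty c) hv, t.ext_zero]
    rw [this]
    exact continuousAt_const
  · rintro s s' hst ⟨W, M, U, h1, h2⟩
    exact ⟨W, M, U, hst.trans h1, h2⟩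
  · rintro s s' ⟨W, M, U, h1, h2, h3, h4, h5⟩ ⟨W', M', U', h1', h2', h3', h4', h5'⟩
    refine ⟨W ∪ W', max M M', U ∩ U', union_subset_union h1 h1', ?_, h3.inter h3', ⟨h4, h4'⟩, ?_⟩
    · refine union_subset (h2.trans ?_) (h2'.trans ?_) <;> refine Icc_subset_Icc ?_ ?_ <;> simp
    · intro y hy t hyt
      have e : (fun z => t.ext z (spectralProj (A z) (W ∪ W'))) = fun z =>
          t.ext z (spectralProj (A z) W) + t.ext z (spectralProj (A z) W') -
            t.ext z (spectralProj (A z) W) * t.ext z (spectralProj (A z) W') := by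
        ext1 z
        rw [spectralProj_union (hd z) (hA z), t.ext_sub, t.ext_add, t.ext_mul]
      have c1 := h5 y hy.1 t hyt
      have c2 := h5' y hy.2 t hyt
      rw [e]
      exact (c1.add c2).sub (c1.mul c2)
  · intro c hc
    obtain ⟨U, ε, hU, hx, hUε⟩ := (h c).2 x
    have hε : 0 < ε := (hUε.1 x hx).1
    refine ⟨Ioo (c - ε) (c + ε), mem_nhdsWithin_of_mem_nhds (Ioo_mem_nhds (by linarith)
      (by linarith)), (fun t => t - c) ⁻¹' Icc (-ε) ε, |c| + ε, U, ?_, ?_, hU, hx, ?_⟩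
    · intro t ht
      simp only [mem_preimage, mem_Icc, mem_Ioo] at *
      constructor <;> linarith
    · intro t ht
      simp only [mem_preimage, mem_Icc] at *
      have := neg_abs_le c
      have := le_abs_self c
      constructor <;> linarith
    · intro y hy t hyt
      have := hUε.continuousAt hU hy hyt
      simp only [spectralProj, spectralSubspace_shift] at this ⊢
      exact this

/-- Two strictly adapted local trivializations define the same convergence of finite rank
perturbations of the positive spectral projections. -/
lemma tendsto_ext_of_strictlyAdapted (hA : ∀ x, IsSelfAdjoint (A x))
    (hd : ∀ x, HasDiscreteSpectrum (A x)) {t t' : HilbertTriv H E} (ht : t.StrictlyAdapted A)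
    (ht' : t'.StrictlyAdapted A) {Z : Type*} {l : Filter Z} {b : Z → X} {x : X}
    (h : x ∈ t.baseSet) (h' : x ∈ t'.baseSet) (hb : Filter.Tendsto b l (𝓝 x))
    {T : ∀ z, E (b z) →L[ℂ] E (b z)} {T₀ : E x →L[ℂ] E x} (hs : IsSelfAdjoint T₀) {ε₀ : ℝ}
    (hε₀ : Enhanced (A x) ε₀) (hf : IsFiniteRank (T₀ - spectralProj (A x) (Ici ε₀)))
    (hT : Filter.Tendsto (fun z => t'.ext (b z) (T z)) l (𝓝 (t'.ext x T₀))) :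
    Filter.Tendsto (fun z => t.ext (b z) (T z)) l (𝓝 (t.ext x T₀)) := by
  obtain ⟨ε, hε, hc⟩ := ht
  obtain ⟨ε', hε', hc'⟩ := ht'
  have c1 : ContinuousAt (fun y => t.ext y (spectralProj (A y) (Ici ε))) x :=
    (t.continuousAt_ext_iff isOpen_univ (mem_univ x) h).2
      (hc.comp (Continuous.subtype_mk continuous_subtype_val fun y => y.2.2)).continuousAt
  have c2 : ContinuousAt (fun y => t'.ext y (spectralProj (A y) (Ici ε'))) x :=
    (t'.continuousAt_ext_iff isOpen_univ (mem_univ x) h').2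
      (hc'.comp (Continuous.subtype_mk continuous_subtype_val fun y => y.2.2)).continuousAt
  -- In `spectralProj_Ici` the factors of the first product are continuous in `t`. The second
  -- product is continuous in `t'`, and carries over to `t` because it has finite rank.
  have c3 : ContinuousAt (fun y => t.ext y
      (spectralProj (A y) (Icc (-ε) ε) * spectralProj (A y) (Ici ε'))) x := by
    refine HilbertTriv.tendsto_ext_of_isFiniteRank h h' Filter.tendsto_id
      ((hε.1 x h).isFiniteRank_spectralProj.mul_right _) ?_ ?_
    · rw [spectralProj_inter (hd x) (hA x)]
      exact proj_isSelfAdjoint _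
    · have := (hε.continuousAt t.open_baseSet h h').mul c2
      simp_rw [HilbertTriv.ext_mul]
      exact this
  have c4 : ContinuousAt (fun y => t.ext y (spectralProj (A y) (Ici ε'))) x := by
    have c5 := (c1.sub (c1.mul (hε'.continuousAt t'.open_baseSet h' h))).add c3
    refine c5.congr ?_
    filter_upwards [t.open_baseSet.mem_nhds h, t'.open_baseSet.mem_nhds h'] with y hy hy'
    conv_rhs => rw [(hε.1 y hy).spectralProj_Ici (hd y) (hA y) (hε'.1 y hy')]
    rw [t.ext_add, mul_sub, mul_one, t.ext_sub, t.ext_mul y (spectralProj (A y) (Ici ε))]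
    rfl
  have hf' : IsFiniteRank (T₀ - spectralProj (A x) (Ici ε')) := by
    -- Once the positive projection is continuous in both trivializations, only the finite rank
    -- difference has to be transferred.
    simpa using hf.sub ((hε₀).isFiniteRank_sub (hd x) (hA x) (hε'.1 x h'))
  have c6 := HilbertTriv.tendsto_ext_of_isFiniteRank h h' hb
    (T := fun z => T z - spectralProj (A (b z)) (Ici ε')) hf' (hs.sub (proj_isSelfAdjoint _)) (by
      simp_rw [HilbertTriv.ext_sub]
      exact hT.sub (c2.tendsto.comp hb))
  have c7 := c6.add (c4.tendsto.comp hb)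
  simp only [HilbertTriv.ext_sub, Function.comp_def, sub_add_cancel] at c7
  exact c7

lemma Gr.isFiniteRank_sub (p : Gr H A) : ∃ ε, Enhanced (A p.base) ε ∧
    IsFiniteRank (proj p.space - spectralProj (A p.base) (Ici ε)) := by
  obtain ⟨ε, h1, h2⟩ := p.commensurable
  exact ⟨ε, h1, h2.isFiniteRank_sub⟩

/-- `Z` stands for the domain of the chart given by `t'`: a set is open in the coinduced topology
once it is open in every such chart. -/
lemma Gr.isOpen_preimage_chart (hA : ∀ x, IsSelfAdjoint (A x))
    (hd : ∀ x, HasDiscreteSpectrum (A x)) {t t' : HilbertTriv H E} (ht : t.StrictlyAdapted A)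
    (ht' : t'.StrictlyAdapted A) {Z : Type*} [TopologicalSpace Z] {v : Z → Gr H A}
    {c : Z → t'.baseSet × (H →L[ℂ] H)} (hc : Continuous c) (hc1 : ∀ z, (c z).1 = (v z).base)
    (hc2 : ∀ z, (c z).2 = t'.ext (v z).base (proj (v z).space))
    {N : Set (H →L[ℂ] H)} (hN : IsOpen N) :
    IsOpen (v ⁻¹' {p | p.base ∈ t.baseSet ∧ t.ext p.base (proj p.space) ∈ N}) := by
  have hb : Continuous fun z => (v z).base :=
    (continuous_subtype_val.comp hc.fst).congr hc1
  refine isOpen_iff_mem_nhds.2 fun q hq => ?_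
  obtain ⟨ε, hε, hf⟩ := (v q).isFiniteRank_sub
  have h1 := tendsto_ext_of_strictlyAdapted hA hd ht ht' (l := 𝓝 q)
    (T := fun z => proj (v z).space) hq.1 (hc1 q ▸ (c q).1.2) (hb.tendsto q)
    (proj_isSelfAdjoint _) hε hf ((hc.snd.congr hc2).tendsto q)
  exact Filter.inter_mem (hb.tendsto q (t.open_baseSet.mem_nhds hq.1))
    (h1 (hN.mem_nhds hq.2))

/-- A strictly adapted local trivialization defines a continuous chart. -/
lemma Gr.isOpen_chart (hA : ∀ x, IsSelfAdjoint (A x))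
    (hd : ∀ x, HasDiscreteSpectrum (A x)) {t : HilbertTriv H E} (ht : t.StrictlyAdapted A)
    {N : Set (H →L[ℂ] H)} (hN : IsOpen N) :
    IsOpen {p : Gr H A | p.base ∈ t.baseSet ∧ t.ext p.base (proj p.space) ∈ N} := by
  refine isOpen_iSup_iff.2 fun t' => isOpen_coinduced.2 ?_
  let τ : TopologicalSpace (Gr.Over H A t'.1) := .induced (Gr.chart H A t'.1) inferInstance
  have hchart : @Continuous _ _ τ _ (Gr.chart H A t'.1) := continuous_induced_dom
  exact @Gr.isOpen_preimage_chart _ _ _ _ _ _ _ _ _ _ _ _ hA hd _ _ ht t'.2 _ τ _ _ hchart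
    (fun _ => rfl) (fun q => (HilbertTriv.ext_of_mem q.2 _).symm) _ hN

lemma continuousAt_ext_of_section (hA : ∀ x, IsSelfAdjoint (A x))
    (hd : ∀ x, HasDiscreteSpectrum (A x)) {S : X → Gr H A} (hS : Continuous S)
    {L : ∀ x, ClosedSubmodule ℂ (E x)}
    {hL : ∀ x, ∃ ε : ℝ, Enhanced (A x) ε ∧ Commensurable (L x) (spectralSubspace (A x) (Ici ε))}
    (hSL : ∀ x, S x = ⟨x, L x, hL x⟩) {t : HilbertTriv H E} (ht : t.StrictlyAdapted A) {x : X}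
    (hx : x ∈ t.baseSet) : ContinuousAt (fun y => t.ext y (proj (L y))) x := by
  refine tendsto_nhds.2 fun N hN hxN => ?_
  have h1 := (Gr.isOpen_chart hA hd ht hN).preimage hS
  have e : S ⁻¹' {p : Gr H A | p.base ∈ t.baseSet ∧ t.ext p.base (proj p.space) ∈ N} =
      {y | y ∈ t.baseSet ∧ t.ext y (proj (L y)) ∈ N} := by
    ext y
    simp only [mem_preimage, mem_ofPred_eq, hSL]
  rw [e] at h1
  filter_upwards [h1.mem_nhds ⟨hx, hxN⟩] with y hy using hy.2

lemma Gr.continuous_of_chart {t : HilbertTriv H E} (ht : t.StrictlyAdapted A) {Z : Type*}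
    [TopologicalSpace Z] {v : Z → Gr.Over H A t} (hv : Continuous fun z => Gr.chart H A t (v z)) :
    Continuous fun z => (v z).1 := by
  let τ : TopologicalSpace (Gr.Over H A t) := .induced (Gr.chart H A t) inferInstance
  have hval : @Continuous _ _ τ _ (Subtype.val : Gr.Over H A t → Gr H A) :=
    continuous_iff_coinduced_le.2 (le_iSup (fun t : {t : HilbertTriv H E // t.StrictlyAdapted A} =>
      TopologicalSpace.coinduced (Subtype.val : Gr.Over H A t.1 → Gr H A)
        (TopologicalSpace.induced (Gr.chart H A t.1) inferInstance)) ⟨t, ht⟩)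
  have h1 : @Continuous _ _ _ τ v := continuous_induced_rng.2 hv
  exact @Continuous.comp _ _ _ _ τ _ _ _ hval h1

lemma Gr.continuous_mk {Z : Type*} [TopologicalSpace Z] {b : Z → X} (hb : Continuous b)
    {L : ∀ z, ClosedSubmodule ℂ (E (b z))}
    (hL : ∀ z, ∃ ε : ℝ, Enhanced (A (b z)) ε ∧
      Commensurable (L z) (spectralSubspace (A (b z)) (Ici ε)))
    (hst : ∀ x, ∃ t : HilbertTriv H E, x ∈ t.baseSet ∧ t.StrictlyAdapted A)
    (hc : ∀ t : HilbertTriv H E, t.StrictlyAdapted A → ∀ z, b z ∈ t.baseSet →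
      ContinuousAt (fun z => t.ext (b z) (proj (L z))) z) :
    Continuous fun z => (⟨b z, L z, hL z⟩ : Gr H A) := by
  refine continuous_iff_continuousAt.2 fun z => ?_
  obtain ⟨t, hz, ht⟩ := hst (b z)
  have hopen : IsOpen (b ⁻¹' t.baseSet) := t.open_baseSet.preimage hb
  rw [← hopen.isOpenEmbedding_subtypeVal.continuousAt_iff (x := (⟨z, hz⟩ : b ⁻¹' t.baseSet))]
  refine (Gr.continuous_of_chart ht (Z := b ⁻¹' t.baseSet)
    (v := fun w => ⟨⟨b w, L w, hL w⟩, w.2⟩) (Continuous.prodMk ?_ ?_)).continuousAt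
  · exact (hb.comp continuous_subtype_val).subtype_mk _
  · refine continuous_iff_continuousAt.2 fun w => ?_
    have := (hc t ht w w.2).comp (f := Subtype.val) (x := w) continuous_subtype_val.continuousAt
    refine this.congr (.of_forall fun w' => ?_)
    exact HilbertTriv.ext_of_mem w'.2 _

end Families

/-! ### Two convex conditions replacing that of being a projection. -/

section Blocks

variable {K : Type*} [NormedAddCommGroup K] [InnerProductSpace ℂ K] [CompleteSpace K]

/-- Self-adjoint finite rank perturbations of `P` which are close to `P`. -/
def nearby (P : K →L[ℂ] K) : Set (K →L[ℂ] K) :=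
  {T | IsSelfAdjoint T ∧ ‖T - P‖ ≤ 1 / 20 ∧ IsFiniteRank (T - P)}

/-- Operators equal to the positive spectral projection of `A` outside the window `[-r, r)`. -/
def blocks (A : K →ₗ.[ℂ] K) (r : ℝ) : Set (K →L[ℂ] K) :=
  {T | (∀ c, r ≤ c → ∀ v ∈ eig A c, T v = v) ∧ ∀ c, c < -r → ∀ v ∈ eig A c, T v = 0}

lemma convex_nearby (P : K →L[ℂ] K) : Convex ℝ (nearby P) := by
  intro S hS T hT a b ha hb hab
  have e : a • S + b • T - P = a • (S - P) + b • (T - P) := by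
    have : P = (a + b) • P := by rw [hab, one_smul]
    conv_lhs => rw [this]
    rw [smul_sub, smul_sub, add_smul]
    abel
  refine ⟨((IsSelfAdjoint.all a).smul hS.1).add ((IsSelfAdjoint.all b).smul hT.1), ?_, ?_⟩
  · rw [e]
    calc _ ≤ a * (1 / 20) + b * (1 / 20) := by
          refine (norm_add_le _ _).trans ?_
          rw [norm_smul, norm_smul, Real.norm_of_nonneg ha, Real.norm_of_nonneg hb]
          gcongr
          exacts [hS.2.1, hT.2.1]
      _ = 1 / 20 := by rw [← add_mul, hab, one_mul]
  · rw [e]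
    exact (hS.2.2.smul a).add (hT.2.2.smul b)

lemma self_mem_nearby {P : K →L[ℂ] K} (hP : IsSelfAdjoint P) : P ∈ nearby P := by
  refine ⟨hP, ?_, ?_⟩
  · rw [sub_self, norm_zero]; norm_num
  · rw [sub_self]; exact .zero

lemma convex_blocks (A : K →ₗ.[ℂ] K) (r : ℝ) : Convex ℝ (blocks A r) := by
  intro S hS T hT a b ha hb hab
  refine ⟨fun c hc v hv => ?_, fun c hc v hv => ?_⟩
  · show a • S v + b • T v = v
    rw [hS.1 c hc v hv, hT.1 c hc v hv, ← add_smul, hab, one_smul]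
  · show a • S v + b • T v = 0
    rw [hS.2 c hc v hv, hT.2 c hc v hv, smul_zero, smul_zero, add_zero]

lemma blocks_mono (A : K →ₗ.[ℂ] K) {r s : ℝ} (h : r ≤ s) : blocks A r ⊆ blocks A s :=
  fun _ hT => ⟨fun c hc => hT.1 c (h.trans hc), fun c hc => hT.2 c (by linarith)⟩

variable {A : K →ₗ.[ℂ] K}

lemma proj_mem_blocks (hd : HasDiscreteSpectrum A) (hA : IsSelfAdjoint A) {L : ClosedSubmodule ℂ K}
    {r : ℝ} (h1 : spectralSubspace A (Ici r) ≤ L) (h2 : L ≤ spectralSubspace A (Ici (-r))) :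
    proj L ∈ blocks A r := by
  refine ⟨fun c hc v hv => proj_eq_self_iff.2 (h1 (hd.eig_le_spectralSubspace hA hc hv)),
    fun c hc v hv => proj_eq_zero_iff.2 fun u hu => ?_⟩
  rw [← inner_conj_symm, inner_eq_zero_of_mem_spectralSubspace (not_le.2 hc) hv (h2 hu), map_zero]

lemma spectralSubspace_le_fixedSpace (hd : HasDiscreteSpectrum A) (hA : IsSelfAdjoint A)
    {T : K →L[ℂ] K} {r : ℝ} (hT : T ∈ blocks A r) (hs : IsSelfAdjoint T) :
    spectralSubspace A (Ici r) ≤ fixedSpace (cfc cutoff T) := by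
  have h : (1 - cfc cutoff T) * spectralProj A (Ici r) = 0 := hd.ext hA fun c v hv => by
    rw [mul_apply_eq_comp, zero_apply]
    by_cases hc : c ∈ Ici r
    · rw [hd.spectralProj_apply_of_mem hA hc hv, sub_apply,
        cutoff_apply_of_apply_eq_self hs (hT.1 c hc v hv), one_apply_eq_self, sub_self]
    · rw [spectralProj_apply_of_notMem hc hv, map_zero]
  intro v hv
  have h2 : (1 - cfc cutoff T) (proj (spectralSubspace A (Ici r)) v) = 0 :=
    congrArg (fun S : K →L[ℂ] K => S v) h
  rw [proj_eq_self_iff.2 hv, sub_apply, one_apply_eq_self, sub_eq_zero] at h2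
  exact mem_fixedSpace.2 h2.symm

lemma fixedSpace_le_spectralSubspace (hd : HasDiscreteSpectrum A) (hA : IsSelfAdjoint A)
    {T : K →L[ℂ] K} {r : ℝ} (hT : T ∈ blocks A r) (hs : IsSelfAdjoint T) :
    fixedSpace (cfc cutoff T) ≤ spectralSubspace A (Ici (-r)) := by
  intro v hv
  have hcs : IsSelfAdjoint (cfc cutoff T) := cfc_predicate _ _
  refine hd.mem_spectralSubspace hA fun c hc u hu => ?_
  rw [← mem_fixedSpace.1 hv, ← inner_apply_left hcs,
    cutoff_apply_of_apply_eq_zero hs (hT.2 c (not_le.1 hc) u hu), inner_zero_left]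

end Blocks

/-! ### Local construction and gluing of operators in block form. -/

section Families

variable {X : Type*} [TopologicalSpace X]
variable {H : Type*} [NormedAddCommGroup H] [InnerProductSpace ℂ H] [CompleteSpace H]
variable {E : X → Type*} [∀ x, NormedAddCommGroup (E x)] [∀ x, InnerProductSpace ℂ (E x)]
variable [TopologicalSpace (TotalSpace H E)] [∀ x, CompleteSpace (E x)]
variable {A : ∀ x, E x →ₗ.[ℂ] E x}

/-- Continuity of a family of bounded operators in strictly adapted local trivializations. -/
def StrictContinuousAt (H : Type*) [NormedAddCommGroup H] [InnerProductSpace ℂ H]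
    [CompleteSpace H] [TopologicalSpace (TotalSpace H E)] (A : ∀ x, E x →ₗ.[ℂ] E x)
    (T : ∀ x, E x →L[ℂ] E x) (x : X) : Prop :=
  ∀ t : HilbertTriv H E, t.StrictlyAdapted A → x ∈ t.baseSet →
    ContinuousAt (fun y => t.ext y (T y)) x

/-- Fiberwise commensurability with the positive spectral subspaces. -/
def FiberwiseCommensurable (A : ∀ x, E x →ₗ.[ℂ] E x) (L : ∀ x, ClosedSubmodule ℂ (E x)) : Prop :=
  ∀ x, ∃ ε : ℝ, Enhanced (A x) ε ∧ Commensurable (L x) (spectralSubspace (A x) (Ici ε))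

/-- Compressing the finite rank part `F` by `Q` makes it vanish on eigenvectors with eigenvalues
outside `W`, leaving there only the positive spectral projection. The compression is close to `F` at
`x`, and nearby by norm continuity. -/
lemma exists_local_block (hA : ∀ x, IsSelfAdjoint (A x)) (hdisc : IsDiscreteSpectrumFamily H A)
    (hst : ∀ x, ∃ t : HilbertTriv H E, x ∈ t.baseSet ∧ t.StrictlyAdapted A)
    {L : ∀ x, ClosedSubmodule ℂ (E x)} (hL : FiberwiseCommensurable A L)
    (hc : ∀ x, StrictContinuousAt H A (fun x => proj (L x)) x) (x : X) :
    ∃ (V : Set X) (T : ∀ y, E y →L[ℂ] E y) (M : ℝ), IsOpen V ∧ x ∈ V ∧ ∀ y ∈ V,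
      T y ∈ nearby (proj (L y)) ∧ T y ∈ blocks (A y) M ∧ StrictContinuousAt H A T y := by
  have hd := hdisc.hasDiscreteSpectrum
  obtain ⟨t, hx, ht⟩ := hst x
  have ht' := ht
  obtain ⟨ε, hε, hcε⟩ := ht'
  have hP : ∀ y ∈ t.baseSet, ContinuousAt (fun y => t.ext y (spectralProj (A y) (Ici ε))) y :=
    fun y hy => (t.continuousAt_ext_iff isOpen_univ (mem_univ y) hy).2
      (hcε.comp (Continuous.subtype_mk continuous_subtype_val fun y => y.2.2)).continuousAt
  let F : ∀ y, E y →L[ℂ] E y := fun y => proj (L y) - spectralProj (A y) (Ici ε)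
  have hFs : ∀ y, IsSelfAdjoint (F y) := fun y =>
    (proj_isSelfAdjoint _).sub (proj_isSelfAdjoint _)
  have hFf : ∀ y ∈ t.baseSet, IsFiniteRank (F y) := fun y hy => by
    obtain ⟨ε', hε', hcomm⟩ := hL y
    have h1 := hε'.isFiniteRank_sub (hd y) (hA y) (hε.1 y hy)
    have h2 : IsFiniteRank (proj (L y) - spectralProj (A y) (Ici ε')) := hcomm.isFiniteRank_sub
    simpa using h2.sub h1
  obtain ⟨n, hn⟩ := (hd x).exists_norm_compress_sub_le (hA x) (hFf x hx) (hFs x)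
    (δ := 1 / 20) (by norm_num)
  obtain ⟨W, M, U, hW, hWM, hU, hxU, hUc⟩ := hdisc.exists_window hA x
    (isCompact_Icc : IsCompact (Icc (-(n : ℝ)) n))
  let Q : ∀ y, E y →L[ℂ] E y := fun y => spectralProj (A y) W
  have hQs : ∀ y, IsSelfAdjoint (Q y) := fun y => proj_isSelfAdjoint _
  let D : ∀ y, E y →L[ℂ] E y := fun y => Q y * F y * Q y - F y
  let T : ∀ y, E y →L[ℂ] E y := fun y => Q y * F y * Q y + spectralProj (A y) (Ici ε)
  have hTD : ∀ y, T y - proj (L y) = D y := fun y => by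
    simp only [T, D]
    rw [show proj (L y) = F y + spectralProj (A y) (Ici ε) from (sub_add_cancel _ _).symm]
    abel
  have hQFs : ∀ y, IsSelfAdjoint (Q y * F y * Q y) := fun y => by
    rw [isSelfAdjoint_iff, star_mul, star_mul, (hQs y).star_eq, (hFs y).star_eq, mul_assoc]
  have hTs : ∀ y, IsSelfAdjoint (T y) := fun y => (hQFs y).add (proj_isSelfAdjoint _)
  have hcF : ∀ y ∈ t.baseSet, ContinuousAt (fun y => t.ext y (F y)) y := fun y hy => by
    simp only [F, HilbertTriv.ext_sub]
    exact (hc y t ht hy).sub (hP y hy)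
  have hcQ : ∀ y ∈ U ∩ t.baseSet, ContinuousAt (fun y => t.ext y (Q y * F y * Q y)) y :=
    fun y hy => by
      simp only [HilbertTriv.ext_mul]
      exact ((hUc y hy.1 t hy.2).mul (hcF y hy.2)).mul (hUc y hy.1 t hy.2)
  have hcD : ContinuousAt (fun y => t.ext y (D y)) x := by
    simp only [D, HilbertTriv.ext_sub]
    exact (hcQ x ⟨hxU, hx⟩).sub (hcF x hx)
  have hnear : ∀ᶠ y in 𝓝 x, ‖t.ext y (D y)‖ < 1 / 20 :=
    hcD.norm.eventually (gt_mem_nhds (by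
      show ‖t.ext x (D x)‖ < 1 / 20
      rw [HilbertTriv.norm_ext hx]; exact hn W hW))
  obtain ⟨V, hVn, hV, hxV⟩ := eventually_nhds_iff.1 hnear
  -- `M + 1` and not `M`, since the eigenvalue `M` may belong to `W`; the bound by `ε` puts all
  -- larger eigenvalues in `[ε, ∞)`.
  refine ⟨V ∩ (U ∩ t.baseSet), T, max (M + 1) ε, hV.inter (hU.inter t.open_baseSet),
    ⟨hxV, hxU, hx⟩, fun y hy => ⟨⟨hTs y, ?_, ?_⟩, ⟨?_, ?_⟩, fun t' ht' hyt' => ?_⟩⟩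
  · rw [hTD, ← HilbertTriv.norm_ext hy.2.2]
    exact (hVn y hy.1).le
  · rw [hTD]
    exact (((hFf y hy.2.2).mul_left _).mul_right _).sub (hFf y hy.2.2)
  · intro c hc v hv
    have h1 : c ∉ W := fun h => by
      have := (hWM h).2
      have := (le_max_left _ _).trans hc
      linarith
    show (Q y * F y) (Q y v) + spectralProj (A y) (Ici ε) v = v
    rw [show Q y v = 0 from spectralProj_apply_of_notMem h1 hv, map_zero, zero_add]
    exact (hd y).spectralProj_apply_of_mem (hA y) ((le_max_right _ _).trans hc) hv
  · intro c hc v hv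
    have h1 : c ∉ W := fun h => by
      have := (hWM h).1
      have := le_max_left (M + 1) ε
      linarith
    have h2 : c ∉ Ici ε := fun h => by
      have h3 : ε ≤ c := h
      have := le_max_right (M + 1) ε
      have := (hε.1 y hy.2.2).1
      linarith
    show (Q y * F y) (Q y v) + spectralProj (A y) (Ici ε) v = 0
    rw [show Q y v = 0 from spectralProj_apply_of_notMem h1 hv, map_zero, zero_add]
    exact spectralProj_apply_of_notMem h2 hv
  · refine tendsto_ext_of_strictlyAdapted hA hd ht' ht hyt' hy.2.2 Filter.tendsto_id (hTs y)
      (hε.1 y hy.2.2) (T := T) ?_ ?_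
    · simp only [T, add_sub_cancel_right]
      exact ((hFf y hy.2.2).mul_left _).mul_right _
    · simp only [T, HilbertTriv.ext_add, id]
      exact (hcQ y hy.2).add (hP y hy.2.2)

lemma exists_global_block [T2Space X] [ParacompactSpace X] (hA : ∀ x, IsSelfAdjoint (A x))
    (hdisc : IsDiscreteSpectrumFamily H A)
    (hst : ∀ x, ∃ t : HilbertTriv H E, x ∈ t.baseSet ∧ t.StrictlyAdapted A)
    {L : ∀ x, ClosedSubmodule ℂ (E x)} (hL : FiberwiseCommensurable A L)
    (hc : ∀ x, StrictContinuousAt H A (fun x => proj (L x)) x) :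
    ∃ (T : ∀ y, E y →L[ℂ] E y) (r : C(X, ℝ)), ∀ y, 0 < r y ∧
      T y ∈ nearby (proj (L y)) ∧ T y ∈ blocks (A y) (r y) ∧ StrictContinuousAt H A T y := by
  choose V T M hV hxV hT using exists_local_block hA hdisc hst hL hc
  obtain ⟨ρ, hρ⟩ := PartitionOfUnity.exists_isSubordinate isClosed_univ V hV
    fun x _ => mem_iUnion.2 ⟨x, hxV x⟩
  have hρV : ∀ i y, ρ i y ≠ 0 → y ∈ V i := fun i y h => hρ i (subset_tsupport _ h)
  -- `r` dominates `M i` wherever `ρ i` is nonzero, so that all the operators averaged at a point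
  -- have block form for the same `r`.
  obtain ⟨r, hr⟩ := exists_continuous_forall_mem_convex_of_local_const
    (t := fun x => {s : ℝ | 0 < s ∧ ∀ i, ρ i x ≠ 0 → M i ≤ s})
    (fun x => by
      have e : {s : ℝ | 0 < s ∧ ∀ i, ρ i x ≠ 0 → M i ≤ s} =
          Ioi 0 ∩ ⋂ i, ⋂ _ : ρ i x ≠ 0, Ici (M i) := by
        ext s; simp
      rw [e]
      exact (convex_Ioi 0).inter (convex_iInter fun i => convex_iInter fun _ => convex_Ici _))
    (fun x => by
      obtain ⟨B, hB⟩ := ((ρ.fintsupport x).image M).bddAbove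
      refine ⟨max B 1, ?_⟩
      filter_upwards [ρ.eventually_finsupport_subset x] with y hy
      refine ⟨lt_max_of_lt_right one_pos, fun i hi => le_max_of_le_left (hB ?_)⟩
      exact Finset.mem_coe.2 (Finset.mem_image_of_mem M (hy ((ρ.mem_finsupport y).2 hi))))
  refine ⟨fun y => ∑ᶠ i, ρ i y • T i y, r, fun y => ⟨(hr y).1, ?_, ?_, fun t ht hyt => ?_⟩⟩
  · exact ρ.finsum_smul_mem_convex (g := fun i _ => T i y) (mem_univ y)
      (fun i hi => (hT i y (hρV i y hi)).1) (convex_nearby _)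
  · exact ρ.finsum_smul_mem_convex (g := fun i _ => T i y) (mem_univ y)
      (fun i hi => blocks_mono _ ((hr y).2 i hi) (hT i y (hρV i y hi)).2.1) (convex_blocks _ _)
  · have h1 : ContinuousAt (fun z => ∑ i ∈ ρ.fintsupport y, ρ i z • t.ext z (T i z)) y := by
      refine tendsto_finsetSum _ fun i hi => ?_
      have hi' : y ∈ tsupport (ρ i) := (ρ.mem_fintsupport_iff y i).1 hi
      exact (ρ i).continuous.continuousAt.smul ((hT i y (hρ i hi')).2.2 t ht hyt)
    refine h1.congr ?_
    filter_upwards [ρ.eventually_finsupport_subset y] with z hz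
    have h2 : ∑ᶠ i, ρ i z • T i z = ∑ i ∈ ρ.fintsupport y, ρ i z • T i z := by
      refine finsum_eq_sum_of_support_subset _ fun i hi => hz ((ρ.mem_finsupport z).2 ?_)
      intro h0
      exact hi (by simp only [h0, zero_smul])
    rw [h2]
    refine Eq.trans ?_ (map_sum (t.extHom z) _ _).symm
    exact Finset.sum_congr rfl fun i _ => (t.ext_smul z _ _).symm

end Families

/-! ### The homotopy and the theorem. -/

section Main

variable {X : Type*} [TopologicalSpace X]
variable {H : Type*} [NormedAddCommGroup H] [InnerProductSpace ℂ H] [CompleteSpace H]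
variable {E : X → Type*} [∀ x, NormedAddCommGroup (E x)] [∀ x, InnerProductSpace ℂ (E x)]
variable [TopologicalSpace (TotalSpace H E)] [∀ x, CompleteSpace (E x)]
variable {A : ∀ x, E x →ₗ.[ℂ] E x}

/-- Moves the subspaces from the fibers over `(S x).base` to the fibers over `x`, where they can be
compared with operators indexed by `x`. -/
lemma IsWeakSpectralSection.exists_fibers {S : C(X, Gr H A)} (hS : IsWeakSpectralSection S) :
    ∃ (L : ∀ x, ClosedSubmodule ℂ (E x)) (hL : FiberwiseCommensurable A L),
      ∀ x, S x = ⟨x, L x, hL x⟩ := by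
  have h : ∀ x, ∃ (L : ClosedSubmodule ℂ (E x)) (hL : ∃ ε : ℝ, Enhanced (A x) ε ∧
      Commensurable L (spectralSubspace (A x) (Ici ε))), S x = ⟨x, L, hL⟩ := by
    intro x
    have h1 := hS x
    generalize S x = p at h1 ⊢
    obtain ⟨b, L, hL⟩ := p
    subst h1
    exact ⟨L, hL, rfl⟩
  choose L hL h2 using h
  exact ⟨L, hL, h2⟩

lemma Gr.mk_congr {x : X} {L L' : ClosedSubmodule ℂ (E x)} (h : L = L') (hL hL') :
    (⟨x, L, hL⟩ : Gr H A) = ⟨x, L', hL'⟩ := by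
  subst h; rfl

lemma Gr.proj_mem_blocks (hd : ∀ x, HasDiscreteSpectrum (A x)) (hA : ∀ x, IsSelfAdjoint (A x))
    {p : Gr H A} {x : X} {L : ClosedSubmodule ℂ (E x)} {hL} (hp : p = ⟨x, L, hL⟩) {r : ℝ}
    (h1 : spectralSubspace (A p.base) (Ici r) ≤ p.space)
    (h2 : p.space ≤ spectralSubspace (A p.base) (Ici (-r))) : proj L ∈ blocks (A x) r := by
  subst hp
  exact GrassmannFamilies.proj_mem_blocks (hd x) (hA x) h1 h2

variable {P T : ∀ y, E y →L[ℂ] E y}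

/-- The closed subspaces obtained from the linear path from `P` to `T`. -/
def pathSpace (P T : ∀ y, E y →L[ℂ] E y) (s : ℝ) (y : X) : ClosedSubmodule ℂ (E y) :=
  fixedSpace (cfc cutoff ((1 - s) • P y + s • T y))

lemma path_mem_nearby {K : Type*} [NormedAddCommGroup K] [InnerProductSpace ℂ K] [CompleteSpace K]
    {L : ClosedSubmodule ℂ K} {T : K →L[ℂ] K} (hT : T ∈ nearby (proj L)) {s : ℝ}
    (hs : s ∈ Icc (0 : ℝ) 1) : (1 - s) • proj L + s • T ∈ nearby (proj L) :=
  convex_nearby _ (self_mem_nearby (proj_isSelfAdjoint L)) hT (sub_nonneg.2 hs.2) hs.1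
    (sub_add_cancel _ _)

lemma path_mem_blocks {K : Type*} [NormedAddCommGroup K] [InnerProductSpace ℂ K] [CompleteSpace K]
    {A : K →ₗ.[ℂ] K} {P T : K →L[ℂ] K} {r : ℝ} (hP : P ∈ blocks A r) (hT : T ∈ blocks A r) {s : ℝ}
    (hs : s ∈ Icc (0 : ℝ) 1) : (1 - s) • P + s • T ∈ blocks A r :=
  convex_blocks _ _ hP hT (sub_nonneg.2 hs.2) hs.1 (sub_add_cancel _ _)

lemma proj_pathSpace {L : ∀ x, ClosedSubmodule ℂ (E x)} (hT : ∀ y, T y ∈ nearby (proj (L y)))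
    {s : ℝ} (hs : s ∈ Icc (0 : ℝ) 1) (y : X) :
    proj (pathSpace (fun y => proj (L y)) T s y) =
      cfc cutoff ((1 - s) • proj (L y) + s • T y) := by
  have h := path_mem_nearby (hT y) hs
  exact proj_fixedSpace (cfc_cutoff_mul_self (proj_mul_self _) (norm_proj_le _) h.1 h.2.1)
    (cfc_predicate _ _)

lemma fiberwiseCommensurable_pathSpace {L : ∀ x, ClosedSubmodule ℂ (E x)}
    (hL : FiberwiseCommensurable A L) (hT : ∀ y, T y ∈ nearby (proj (L y)))
    {s : ℝ} (hs : s ∈ Icc (0 : ℝ) 1) :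
    FiberwiseCommensurable A (pathSpace (fun y => proj (L y)) T s) := by
  intro y
  obtain ⟨ε, hε, h1⟩ := hL y
  refine ⟨ε, hε, commensurable_of_isFiniteRank_sub ?_⟩
  have h := path_mem_nearby (hT y) hs
  rw [proj_pathSpace hT hs]
  simpa using (isFiniteRank_cfc_cutoff_sub (proj_mul_self _) h.1 h.2.2).add h1.isFiniteRank_sub

lemma continuousAt_ext_pathSpace {L : ∀ x, ClosedSubmodule ℂ (E x)}
    (hT : ∀ y, T y ∈ nearby (proj (L y)))
    {t : HilbertTriv H E} {y : X} (hy : y ∈ t.baseSet)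
    (hcL : ContinuousAt (fun y => t.ext y (proj (L y))) y)
    (hcT : ContinuousAt (fun y => t.ext y (T y)) y) (s : unitInterval) :
    ContinuousAt (fun z : unitInterval × X =>
      t.ext z.2 (proj (pathSpace (fun y => proj (L y)) T z.1 z.2))) (s, y) := by
  let G : unitInterval × X → H →L[ℂ] H := fun z =>
    t.ext z.2 ((1 - (z.1 : ℝ)) • proj (L z.2) + (z.1 : ℝ) • T z.2)
  have hmem : ∀ z : unitInterval × X,
      (1 - (z.1 : ℝ)) • proj (L z.2) + (z.1 : ℝ) • T z.2 ∈ nearby (proj (L z.2)) := fun z =>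
    path_mem_nearby (hT z.2) z.1.2
  have hGs : ∀ z, IsSelfAdjoint (G z) := fun z => t.isSelfAdjoint_ext (hmem z).1
  have hGn : ∀ z, ‖G z‖ ≤ 2 := fun z => by
    refine (t.norm_ext_le _ _).trans ?_
    have h1 := (hmem z).2.1
    have h2 := norm_proj_le (L z.2)
    have h3 := norm_le_norm_sub_add ((1 - (z.1 : ℝ)) • proj (L z.2) + (z.1 : ℝ) • T z.2)
      (proj (L z.2))
    linarith
  have hG : ContinuousAt G (s, y) := by
    simp only [G, HilbertTriv.ext_add, HilbertTriv.ext_smul]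
    have c1 : ContinuousAt (fun z : unitInterval × X => (z.1 : ℝ)) (s, y) := by fun_prop
    have c2 : ContinuousAt (fun z : unitInterval × X => t.ext z.2 (proj (L z.2))) (s, y) :=
      ContinuousAt.comp (f := Prod.snd) (x := (s, y)) hcL continuousAt_snd
    have c3 : ContinuousAt (fun z : unitInterval × X => t.ext z.2 (T z.2)) (s, y) :=
      ContinuousAt.comp (f := Prod.snd) (x := (s, y)) hcT continuousAt_snd
    exact ((continuousAt_const.sub c1).smul c2).add (c1.smul c3)
  have h1 := tendsto_cfc_cutoff hG hGs (hGs _) hGn (hGn _)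
  have h2 : ContinuousAt (fun z => cfc cutoff (G z)) (s, y) := h1
  refine h2.congr ?_
  filter_upwards [(continuousAt_snd (p := (s, y))) (t.open_baseSet.mem_nhds hy)] with z hz
  rw [proj_pathSpace hT z.1.2]
  exact (t.ext_cfc (hmem z).1 continuous_cutoff hz).symm

/-- Spectral inclusions hold at every moment of the path if they hold at its ends. -/
lemma pathSpace_bounds (hd : ∀ x, HasDiscreteSpectrum (A x)) (hA : ∀ x, IsSelfAdjoint (A x))
    {y : X} {r : ℝ} {s : ℝ} (h : (1 - s) • P y + s • T y ∈ blocks (A y) r)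
    (hs : IsSelfAdjoint ((1 - s) • P y + s • T y)) :
    spectralSubspace (A y) (Ici r) ≤ pathSpace P T s y ∧
      pathSpace P T s y ≤ spectralSubspace (A y) (Ici (-r)) :=
  ⟨spectralSubspace_le_fixedSpace (hd y) (hA y) h hs,
    fixedSpace_le_spectralSubspace (hd y) (hA y) h hs⟩

theorem exists_homotopic_spectralSection [T2Space X] [ParacompactSpace X]
    (hA : ∀ x, IsSelfAdjoint (A x)) (hdisc : IsDiscreteSpectrumFamily H A)
    (hst : ∀ x, ∃ t : HilbertTriv H E, x ∈ t.baseSet ∧ t.StrictlyAdapted A)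
    (S : C(X, Gr H A)) (Y : Set X) (hY : IsSpectralSectionOn S Y) :
    ∃ S' : C(X, Gr H A), IsSpectralSection S' ∧
      ContinuousMap.HomotopicWith S S' fun T => IsSpectralSectionOn T Y := by
  have hd := hdisc.hasDiscreteSpectrum
  obtain ⟨L, hL, hSL⟩ := hY.1.exists_fibers
  have hc : ∀ x, StrictContinuousAt H A (fun x => proj (L x)) x := fun x t ht hx =>
    continuousAt_ext_of_section hA hd S.continuous hSL ht hx
  obtain ⟨T, r, hT⟩ := exists_global_block hA hdisc hst hL hc
  have hTn : ∀ y, T y ∈ nearby (proj (L y)) := fun y => (hT y).2.1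
  have hmem : ∀ (s : unitInterval) y,
      IsSelfAdjoint ((1 - (s : ℝ)) • proj (L y) + (s : ℝ) • T y) := fun s y =>
    (path_mem_nearby (hTn y) s.2).1
  let P : ∀ y, E y →L[ℂ] E y := fun y => proj (L y)
  let Φ : C(unitInterval × X, Gr H A) :=
    ⟨fun z => ⟨z.2, pathSpace P T z.1 z.2, fiberwiseCommensurable_pathSpace hL hTn z.1.2 z.2⟩,
      Gr.continuous_mk continuous_snd _ hst fun t ht z hz =>
        continuousAt_ext_pathSpace hTn hz (hc z.2 t ht hz) ((hT z.2).2.2.2 t ht hz) z.1⟩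
  let S' : C(X, Gr H A) := Φ.comp ⟨fun y => (1, y), by fun_prop⟩
  have hΦ0 : ∀ y, Φ (0, y) = S y := fun y => by
    rw [hSL]
    refine Gr.mk_congr ?_ _ _
    simp only [pathSpace, P, Icc.coe_zero, sub_zero, one_smul, zero_smul, add_zero]
    rw [cfc_cutoff_eq_self (proj_mul_self _) (proj_isSelfAdjoint _), fixedSpace_proj]
  refine ⟨S', ⟨fun _ => rfl, ⟨fun y => r y, by fun_prop⟩, fun y => ⟨(hT y).1, ?_⟩⟩,
    ⟨{ toContinuousMap := Φ, map_zero_left := hΦ0, map_one_left := fun _ => rfl,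
       prop' := fun s => ⟨fun _ => rfl, ?_⟩ }⟩⟩
  · refine pathSpace_bounds (P := P) hd hA ?_ (hmem 1 y)
    show (1 - ((1 : unitInterval) : ℝ)) • P y + ((1 : unitInterval) : ℝ) • T y ∈
      blocks (A y) (r y)
    simp only [Icc.coe_one, sub_self, zero_smul, one_smul, zero_add]
    exact (hT y).2.2.1
  · obtain ⟨-, q, hq⟩ := hY
    -- Over `Y` the initial projection has block form for `q` and `T` for `r`; both have it for the
    -- maximum, and convexity gives the whole segment.
    refine ⟨⟨fun y => max (q y) (r y), by fun_prop⟩, fun y =>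
      ⟨lt_max_of_lt_left (hq y).1, pathSpace_bounds (P := P) hd hA ?_ (hmem s y)⟩⟩
    exact path_mem_blocks
      (blocks_mono _ (le_max_left _ _) (Gr.proj_mem_blocks hd hA (hSL y) (hq y).2.1 (hq y).2.2))
      (blocks_mono _ (le_max_right _ _) (hT y).2.2.1) s.2

end Main

end GrassmannFamilies

end

open GrassmannFamilies
theorem mainTheorem3 {X : Type*} [TopologicalSpace X] [T2Space X] [ParacompactSpace X]
    {H : Type*} [NormedAddCommGroup H] [InnerProductSpace ℂ H] [CompleteSpace H]
    [TopologicalSpace.SeparableSpace H] (_hH : ¬ FiniteDimensional ℂ H)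
    {E : X → Type*} [∀ x, NormedAddCommGroup (E x)] [∀ x, InnerProductSpace ℂ (E x)]
    [∀ x, CompleteSpace (E x)]
    [TopologicalSpace (Bundle.TotalSpace H E)] [IsHilbertBundle H E]
    (A : ∀ x, E x →ₗ.[ℂ] E x)
    (hself : ∀ x, IsSelfAdjoint (A x))
    (hess : ∀ x, ¬ EssentiallyPositive (A x) ∧ ¬ EssentiallyNegative (A x))
    (hdisc : IsDiscreteSpectrumFamily H A)
    (hstrict : IsStrictlyFredholmFamily H A)
    (S : C(X, Gr H A)) (hS : IsWeakSpectralSection S) :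
    (∃ S' : C(X, Gr H A), IsSpectralSection S' ∧
      ContinuousMap.HomotopicWith S S' IsWeakSpectralSection) ∧
    (∀ Y : Set X, IsSpectralSectionOn S Y →
      ∃ S' : C(X, Gr H A), IsSpectralSection S' ∧
        ContinuousMap.HomotopicWith S S' fun T => IsSpectralSectionOn T Y) := by
  have main := exists_homotopic_spectralSection hself hdisc hstrict.2 S
  refine ⟨?_, main⟩
  -- Over `Y = ∅` the spectral condition is vacuous, so the relative statement contains the absolute
  -- one.
  obtain ⟨S', hS', ⟨F⟩⟩ := main ∅ ⟨hS, ContinuousMap.const _ 1, fun y => y.2.elim⟩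
  exact ⟨S', hS', ⟨{ toHomotopy := F.toHomotopy, prop' := fun s => (F.prop s).1 }⟩⟩
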